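/- Let $(W,S)$ be a Coxeter system with length function $\ell$ and Chevalley--Bruhat order $<$, and let $\mathcal H$ be its Iwahori--Hecke algebra over $\mathbb Z[t,t^{-1}]$: the algebra with basis $T_w$ ($w\in W$) such that, for $s\in S$, $T_sT_w=T_{sw}$ if $sw>w$ and $T_sT_w=(t^2-1)T_w+t^2T_{sw}$ if $sw<w$. Let $C'_w=t^{-\ell(w)}\sum_{y\le w}P_{y,w}(t^2)\,T_y$ be the Kazhdan--Lusztig basis of $\mathcal H$, where the $P_{y,w}$ are the Kazhdan--Lusztig polynomials; in particular $C'_s=t^{-1}(T_s+1)$. Let $\mathcal C\subseteq W$ be a left cell and $M_{\mathcal C}$ its left cell representation, that is, the quotient of the left ideal spanned by all $C'_y$ with $y\le_L w$ for some $w\in\mathcal C$ by the left ideal spanned by those of these $C'_y$ with $y\notin\mathcal C$; for $x\in\mathcal C$ let $c_x\in M_{\mathcal C}$ be the class of $C'_x$. Let $K$ be an integral domain that is a $\mathbb Z[t,t^{-1}]$-algebra in which $t+t^{-1}\neq 0$ (for example $\mathbb Z[t,t^{-1}]$ or $\mathbb Q(t)$), extend the scalars of $M_{\mathcal C}$ to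 $K$, and let $\langle\ ,\ \rangle$ be a symmetric $K$-bilinear form on the resulting representation. (1) For each $s\in S$, the equations \[(t+t^{-1})\langle c_x,c_w\rangle=\langle c_x,C'_s c_w\rangle\qquad\text{for all }x,w\in\mathcal C\text{ with }sx<x\text{ and }sw>w\] hold if and only if the form is invariant under $C'_s$, that is, $\langle C'_s v,v'\rangle=\langle v,C'_s v'\rangle$ for all $v,v'$. (2) These equations hold for all $s\in S$ if and only if the form is $\mathcal H$-invariant, that is, $\langle T_y v,v'\rangle=\langle v,T_{y^{-1}}v'\rangle$ for all $y\in W$ and all $v,v'$. -/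

import Mathlib

open scoped LaurentPolynomial Polynomial TensorProduct

namespace CoxeterSystem

variable {B W : Type*} [Group W] {M : CoxeterMatrix B} (cs : CoxeterSystem M W)

section Exchange

open scoped Classical in
/-- The action of a simple reflection on pairs (element of `W`, parity), used for the exchange
condition. -/
noncomputable def reflAct (i : B) : Function.End (W × ZMod 2) := fun p =>
  (cs.simple i * p.1 * cs.simple i, p.2 + if p.1 = cs.simple i then 1 else 0)

open scoped Classical in
theorem reflAct_apply (i : B) (p : W × ZMod 2) : cs.reflAct i p =
    (cs.simple i * p.1 * cs.simple i, p.2 + if p.1 = cs.simple i then 1 else 0) := rfl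

theorem end_mul_apply {X : Type*} (f g : Function.End X) (p : X) : (f * g) p = f (g p) := rfl

theorem end_one_apply {X : Type*} (p : X) : (1 : Function.End X) p = p := rfl

open scoped Classical in
theorem reflAct_pow (i j : B) (n : ℕ) (t : W) (e : ZMod 2) :
    ((cs.reflAct i * cs.reflAct j) ^ n) (t, e) =
      ((cs.simple i * cs.simple j) ^ n * t * (cs.simple j * cs.simple i) ^ n,
        e + ∑ k ∈ Finset.range (2 * n),
          if t = (cs.simple j * cs.simple i) ^ k * cs.simple j then 1 else 0) := by
  have hinv : ∀ n : ℕ, ((cs.simple i * cs.simple j) ^ n)⁻¹ = (cs.simple j * cs.simple i) ^ n := by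
    intro n
    rw [← inv_pow]; simp
  have hsh : ∀ n : ℕ, (cs.simple j * cs.simple i) ^ n * cs.simple j
      = cs.simple j * (cs.simple i * cs.simple j) ^ n := by
    intro n
    induction n with
    | zero => simp
    | succ n ih => rw [pow_succ', mul_assoc, ih, pow_succ' (cs.simple i * cs.simple j)]
                   simp only [mul_assoc]
  have key : ∀ (n : ℕ) (u v : W), (cs.simple i * cs.simple j) ^ n * u * (cs.simple j * cs.simple i) ^ n = v ↔
      u = (cs.simple j * cs.simple i) ^ n * v * (cs.simple i * cs.simple j) ^ n := by
    intro n u v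
    rw [← hinv]
    constructor
    · rintro rfl; group
    · rintro rfl; group
  induction n with
  | zero => simp [end_one_apply]
  | succ n ih =>
    rw [pow_succ', end_mul_apply, ih, end_mul_apply]
    have h1 : ((cs.simple i * cs.simple j) ^ n * t * (cs.simple j * cs.simple i) ^ n
        = cs.simple j) ↔ t = (cs.simple j * cs.simple i) ^ (2 * n) * cs.simple j := by
      rw [key, two_mul, pow_add, mul_assoc, mul_assoc, hsh]
    have h2 : (cs.simple j * ((cs.simple i * cs.simple j) ^ n * t *
        (cs.simple j * cs.simple i) ^ n) * cs.simple j = cs.simple i) ↔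
        t = (cs.simple j * cs.simple i) ^ (2 * n + 1) * cs.simple j := by
      have : (cs.simple j * ((cs.simple i * cs.simple j) ^ n * t *
        (cs.simple j * cs.simple i) ^ n) * cs.simple j = cs.simple i) ↔
        (cs.simple i * cs.simple j) ^ n * t * (cs.simple j * cs.simple i) ^ n
          = cs.simple j * cs.simple i * cs.simple j := by
        generalize (cs.simple i * cs.simple j) ^ n * t * (cs.simple j * cs.simple i) ^ n = u
        constructor
        · intro h; rw [← h]; simp [mul_assoc]
        · intro h; rw [h]; simp [mul_assoc]
      rw [this, key, show 2 * n + 1 = n + 1 + n by ring, pow_add,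
        mul_assoc ((cs.simple j * cs.simple i) ^ (n + 1)), hsh, pow_succ]
      simp only [mul_assoc]
    rw [show 2 * (n + 1) = 2 * n + 1 + 1 by ring, Finset.sum_range_succ, Finset.sum_range_succ]
    rw [reflAct_apply, reflAct_apply]
    dsimp only
    rw [if_congr h1 rfl rfl, if_congr h2 rfl rfl]
    refine Prod.ext ?_ ?_
    · rw [pow_succ' (cs.simple i * cs.simple j) n, pow_succ (cs.simple j * cs.simple i) n]
      simp only [mul_assoc]
    · simp only [add_assoc]

theorem reflAct_liftable : M.IsLiftable cs.reflAct := by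
  classical
  intro i j
  funext ⟨t, e⟩
  rw [reflAct_pow, simple_mul_simple_pow, simple_mul_simple_pow', two_mul, Finset.sum_range_add]
  simp only [pow_add, simple_mul_simple_pow', one_mul, mul_one]
  rw [CharTwo.add_self_eq_zero]
  simp [end_one_apply]

open scoped Classical in
theorem reflAct_word (ω : List B) (t : W) (e : ZMod 2) :
    (ω.map cs.reflAct).prod (t, e) =
      (cs.wordProd ω * t * (cs.wordProd ω)⁻¹, e + ((cs.rightInvSeq ω).count t : ZMod 2)) := by
  induction ω with
  | nil => simp [end_one_apply]
  | cons i ω ih =>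
    rw [List.map_cons, List.prod_cons, end_mul_apply, ih]
    simp only [reflAct, wordProd_cons, rightInvSeq, List.count_cons]
    refine Prod.ext ?_ ?_
    · simp [mul_assoc]
    · have : (cs.wordProd ω * t * (cs.wordProd ω)⁻¹ = cs.simple i) ↔
          ((cs.wordProd ω)⁻¹ * cs.simple i * cs.wordProd ω == t) = true := by
        rw [beq_iff_eq]
        constructor
        · intro h; rw [← h]; group
        · rintro rfl; group
      simp only [if_congr this rfl rfl]
      push_cast
      simp [add_assoc]

theorem reflAct_prod_eq (ω : List B) :
    (ω.map cs.reflAct).prod = cs.lift ⟨cs.reflAct, cs.reflAct_liftable⟩ (cs.wordProd ω) := by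
  rw [wordProd, map_list_prod, List.map_map]
  congr 1
  refine List.map_congr_left fun i _ => ?_
  rw [Function.comp_apply, lift_apply_simple]

/-- The exchange condition for a right descent. -/
theorem exists_eraseIdx_of_isRightDescent {ω : List B} {j : B}
    (h : cs.IsRightDescent (cs.wordProd ω) j) :
    ∃ k < ω.length, cs.wordProd ω * cs.simple j = cs.wordProd (ω.eraseIdx k) := by
  classical
  obtain ⟨ω', hω', hw⟩ := cs.exists_isReduced (cs.wordProd ω * cs.simple j)
  have hprod : cs.wordProd (ω'.concat j) = cs.wordProd ω := by
    rw [wordProd_concat, ← hw]; simp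
  have hred : cs.IsReduced (ω'.concat j) := by
    rw [IsReduced, hprod, List.length_concat, ← hω'.eq, ← hw]
    exact ((cs.isRightDescent_iff).1 h).symm
  have hcount : (cs.rightInvSeq (ω'.concat j)).count (cs.simple j) = 1 :=
    List.count_eq_one_of_mem hred.nodup_rightInvSeq (by rw [rightInvSeq_concat]; simp)
  have heq : ((ω'.concat j).map cs.reflAct).prod = (ω.map cs.reflAct).prod := by
    rw [reflAct_prod_eq, reflAct_prod_eq, hprod]
  have h2 := congrArg Prod.snd (congrFun heq (cs.simple j, 0))
  rw [reflAct_word, reflAct_word, hcount] at h2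
  have hmem : cs.simple j ∈ cs.rightInvSeq ω := by
    by_contra hne
    rw [List.count_eq_zero_of_not_mem hne] at h2
    simp at h2
  obtain ⟨k, hk, hk'⟩ := List.getElem_of_mem hmem
  refine ⟨k, by simpa using hk, ?_⟩
  rw [← wordProd_mul_getD_rightInvSeq, List.getD_eq_getElem _ _ hk, hk']

/-- If `s w > w`, `w t > w` and `s w t < s w`, then `s w = w t`. -/
theorem simple_mul_eq_mul_simple {w : W} {i j : B} (hi : ¬ cs.IsLeftDescent w i)
    (hj : ¬ cs.IsRightDescent w j) (hij : cs.IsRightDescent (cs.simple i * w) j) :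
    cs.simple i * w = w * cs.simple j := by
  obtain ⟨ω, hω, rfl⟩ := cs.exists_isReduced w
  rw [← wordProd_cons] at hij
  obtain ⟨k, hk, h⟩ := cs.exists_eraseIdx_of_isRightDescent hij
  cases k with
  | zero =>
    simp only [List.eraseIdx_cons_zero] at h
    rw [← wordProd_cons, ← h]; simp
  | succ k =>
    exfalso
    rw [List.eraseIdx_cons_succ, wordProd_cons, wordProd_cons, mul_assoc, mul_right_inj] at h
    have h1 := cs.length_wordProd_le (ω.eraseIdx k)
    have hk' : k < ω.length := by simpa using hk
    rw [← h, (cs.not_isRightDescent_iff).1 hj, hω.eq, List.length_eraseIdx_of_lt hk'] at h1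
    omega

end Exchange

section HeckeAlgebra

/-- The Iwahori-Hecke algebra of `(W, S)` over `ℤ[t, t⁻¹]` with parameter `q = t ^ 2`: the free
module with basis `T_w` (`w ∈ W`), with the multiplication defined below. -/
def HeckeAlgebra (_cs : CoxeterSystem M W) : Type _ := W →₀ ℤ[T;T⁻¹]

noncomputable instance : AddCommGroup cs.HeckeAlgebra := inferInstanceAs (AddCommGroup (W →₀ _))
noncomputable instance : Module ℤ[T;T⁻¹] cs.HeckeAlgebra :=
  inferInstanceAs (Module ℤ[T;T⁻¹] (W →₀ ℤ[T;T⁻¹]))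

/-- The standard basis element `T_w`. -/
noncomputable def heckeT (w : W) : cs.HeckeAlgebra := Finsupp.single w (1 : ℤ[T;T⁻¹])

/-- The elements `T_w` form a basis. -/
noncomputable def heckeBasis : Module.Basis W ℤ[T;T⁻¹] cs.HeckeAlgebra := ⟨LinearEquiv.refl _ _⟩

theorem heckeBasis_apply (w : W) : cs.heckeBasis w = cs.heckeT w := rfl

open scoped Classical in
/-- Left multiplication by `T_s`: `T_s T_w = T_{sw}` if `sw > w`, and
`T_s T_w = (q - 1) T_w + q T_{sw}` if `sw < w`. -/
noncomputable def heckeLeft (i : B) : Module.End ℤ[T;T⁻¹] cs.HeckeAlgebra :=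
  cs.heckeBasis.constr ℤ fun w =>
    if cs.IsLeftDescent w i then
      (LaurentPolynomial.T 2 - 1 : ℤ[T;T⁻¹]) • cs.heckeT w +
        (LaurentPolynomial.T 2 : ℤ[T;T⁻¹]) • cs.heckeT (cs.simple i * w)
    else cs.heckeT (cs.simple i * w)

open scoped Classical in
/-- Right multiplication by `T_s`. -/
noncomputable def heckeRight (i : B) : Module.End ℤ[T;T⁻¹] cs.HeckeAlgebra :=
  cs.heckeBasis.constr ℤ fun w =>
    if cs.IsRightDescent w i then
      (LaurentPolynomial.T 2 - 1 : ℤ[T;T⁻¹]) • cs.heckeT w +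
        (LaurentPolynomial.T 2 : ℤ[T;T⁻¹]) • cs.heckeT (w * cs.simple i)
    else cs.heckeT (w * cs.simple i)

theorem heckeLeft_of_isLeftDescent {i : B} {w : W} (h : cs.IsLeftDescent w i) :
    cs.heckeLeft i (cs.heckeT w) = (LaurentPolynomial.T 2 - 1 : ℤ[T;T⁻¹]) • cs.heckeT w +
        (LaurentPolynomial.T 2 : ℤ[T;T⁻¹]) • cs.heckeT (cs.simple i * w) := by
  rw [heckeLeft, ← heckeBasis_apply, Module.Basis.constr_basis, if_pos h, heckeBasis_apply]

theorem heckeLeft_of_not_isLeftDescent {i : B} {w : W} (h : ¬ cs.IsLeftDescent w i) :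
    cs.heckeLeft i (cs.heckeT w) = cs.heckeT (cs.simple i * w) := by
  rw [heckeLeft, ← heckeBasis_apply, Module.Basis.constr_basis, if_neg h]

theorem heckeRight_of_isRightDescent {i : B} {w : W} (h : cs.IsRightDescent w i) :
    cs.heckeRight i (cs.heckeT w) = (LaurentPolynomial.T 2 - 1 : ℤ[T;T⁻¹]) • cs.heckeT w +
        (LaurentPolynomial.T 2 : ℤ[T;T⁻¹]) • cs.heckeT (w * cs.simple i) := by
  rw [heckeRight, ← heckeBasis_apply, Module.Basis.constr_basis, if_pos h, heckeBasis_apply]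

theorem heckeRight_of_not_isRightDescent {i : B} {w : W} (h : ¬ cs.IsRightDescent w i) :
    cs.heckeRight i (cs.heckeT w) = cs.heckeT (w * cs.simple i) := by
  rw [heckeRight, ← heckeBasis_apply, Module.Basis.constr_basis, if_neg h]

theorem commute_heckeLeft_heckeRight (i j : B) : Commute (cs.heckeLeft i) (cs.heckeRight j) := by
  refine cs.heckeBasis.ext fun w => ?_
  rw [heckeBasis_apply, Module.End.mul_apply, Module.End.mul_apply]
  have e1 := cs.length_simple_mul (w * cs.simple j) i
  have e2 := cs.length_mul_simple (cs.simple i * w) j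
  have e3 := cs.length_simple_mul w i
  have e4 := cs.length_mul_simple w j
  rw [← mul_assoc] at e1
  by_cases hi : cs.IsLeftDescent w i <;> by_cases hj : cs.IsRightDescent w j
  · by_cases hk : cs.IsRightDescent (cs.simple i * w) j
    · have hk' : cs.IsLeftDescent (w * cs.simple j) i := by
        simp only [IsLeftDescent, IsRightDescent, ← mul_assoc] at *; omega
      rw [heckeLeft_of_isLeftDescent _ hi, heckeRight_of_isRightDescent _ hj]
      simp only [map_add, map_smul]
      rw [heckeLeft_of_isLeftDescent _ hi, heckeRight_of_isRightDescent _ hj,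
        heckeLeft_of_isLeftDescent _ hk', heckeRight_of_isRightDescent _ hk, ← mul_assoc]
      module
    · have hk' : ¬ cs.IsLeftDescent (w * cs.simple j) i := by
        simp only [IsLeftDescent, IsRightDescent, ← mul_assoc] at *; omega
      have h := cs.simple_mul_eq_mul_simple (w := cs.simple i * w) (i := i) (j := j)
        (by simp only [IsLeftDescent, simple_mul_simple_cancel_left] at *; omega) hk (by simpa)
      have h' : cs.simple i * w = w * cs.simple j := by
        rw [simple_mul_simple_cancel_left] at h
        nth_rw 2 [h]
        simp
      rw [heckeLeft_of_isLeftDescent _ hi, heckeRight_of_isRightDescent _ hj]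
      simp only [map_add, map_smul]
      rw [heckeLeft_of_isLeftDescent _ hi, heckeRight_of_isRightDescent _ hj,
        heckeLeft_of_not_isLeftDescent _ hk', heckeRight_of_not_isRightDescent _ hk, ← mul_assoc,
        h']
  · have hk : ¬ cs.IsRightDescent (cs.simple i * w) j := by
      simp only [IsLeftDescent, IsRightDescent] at *; omega
    have hk' : cs.IsLeftDescent (w * cs.simple j) i := by
      simp only [IsLeftDescent, IsRightDescent, ← mul_assoc] at *; omega
    rw [heckeLeft_of_isLeftDescent _ hi, heckeRight_of_not_isRightDescent _ hj]
    simp only [map_add, map_smul]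
    rw [heckeRight_of_not_isRightDescent _ hj,
      heckeLeft_of_isLeftDescent _ hk', heckeRight_of_not_isRightDescent _ hk, ← mul_assoc]
  · have hk : cs.IsRightDescent (cs.simple i * w) j := by
      simp only [IsLeftDescent, IsRightDescent] at *; omega
    have hk' : ¬ cs.IsLeftDescent (w * cs.simple j) i := by
      simp only [IsLeftDescent, IsRightDescent, ← mul_assoc] at *; omega
    rw [heckeLeft_of_not_isLeftDescent _ hi, heckeRight_of_isRightDescent _ hj]
    simp only [map_add, map_smul]
    rw [heckeLeft_of_not_isLeftDescent _ hi,
      heckeLeft_of_not_isLeftDescent _ hk', heckeRight_of_isRightDescent _ hk, ← mul_assoc]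
  · rw [heckeLeft_of_not_isLeftDescent _ hi, heckeRight_of_not_isRightDescent _ hj]
    by_cases hk : cs.IsRightDescent (cs.simple i * w) j
    · have hk' : cs.IsLeftDescent (w * cs.simple j) i := by
        simp only [IsLeftDescent, IsRightDescent, ← mul_assoc] at *; omega
      have h' := cs.simple_mul_eq_mul_simple hi hj hk
      rw [heckeLeft_of_isLeftDescent _ hk', heckeRight_of_isRightDescent _ hk, ← mul_assoc, h']
    · have hk' : ¬ cs.IsLeftDescent (w * cs.simple j) i := by
        simp only [IsLeftDescent, IsRightDescent, ← mul_assoc] at *; omega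
      rw [heckeLeft_of_not_isLeftDescent _ hk', heckeRight_of_not_isRightDescent _ hk, ← mul_assoc]

/-- An operator commuting with all right multiplications is determined by its value at `T_1`. -/
theorem hecke_end_ext {f g : Module.End ℤ[T;T⁻¹] cs.HeckeAlgebra}
    (hf : ∀ j, Commute f (cs.heckeRight j)) (hg : ∀ j, Commute g (cs.heckeRight j))
    (h : f (cs.heckeT 1) = g (cs.heckeT 1)) : f = g := by
  refine cs.heckeBasis.ext fun w => ?_
  rw [heckeBasis_apply]
  induction hn : cs.length w generalizing w with
  | zero => rw [cs.length_eq_zero_iff.1 hn, h]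
  | succ n ih =>
    have hw : w ≠ 1 := by rintro rfl; simp at hn
    obtain ⟨j, hj⟩ := cs.exists_rightDescent_of_ne_one hw
    have hl := cs.isRightDescent_iff.1 hj
    have hw' : cs.heckeT w = cs.heckeRight j (cs.heckeT (w * cs.simple j)) := by
      rw [heckeRight_of_not_isRightDescent _ (cs.isRightDescent_iff_not_isRightDescent_mul.1 hj)]
      simp
    rw [hw', ← Module.End.mul_apply, ← Module.End.mul_apply, (hf j).eq, (hg j).eq,
      Module.End.mul_apply, Module.End.mul_apply, ih _ (by omega)]

theorem heckeLeft_prod_of_isReduced {ω : List B} (hω : cs.IsReduced ω) :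
    (ω.map cs.heckeLeft).prod (cs.heckeT 1) = cs.heckeT (cs.wordProd ω) := by
  induction ω with
  | nil => simp
  | cons i ω ih =>
    have h : cs.IsReduced ω := hω.drop 1
    rw [List.map_cons, List.prod_cons, Module.End.mul_apply, ih h,
      heckeLeft_of_not_isLeftDescent, wordProd_cons]
    have h1 := hω.eq
    rw [wordProd_cons, List.length_cons] at h1
    rw [IsLeftDescent, h1, h.eq]
    omega

/-- The left multiplication operators of the Hecke algebra: `T_w` acts as
`T_{s_1} ⋯ T_{s_k}`, where `w = s_1 ⋯ s_k` is a reduced expression. -/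
noncomputable def heckeMulLeft :
    cs.HeckeAlgebra →ₗ[ℤ[T;T⁻¹]] Module.End ℤ[T;T⁻¹] cs.HeckeAlgebra :=
  cs.heckeBasis.constr ℤ fun w => ((cs.exists_isReduced w).choose.map cs.heckeLeft).prod

theorem heckeMulLeft_heckeT (w : W) : cs.heckeMulLeft (cs.heckeT w) =
    ((cs.exists_isReduced w).choose.map cs.heckeLeft).prod := by
  rw [heckeMulLeft, ← heckeBasis_apply, Module.Basis.constr_basis]

theorem commute_heckeMulLeft (a : cs.HeckeAlgebra) (j : B) :
    Commute (cs.heckeMulLeft a) (cs.heckeRight j) := by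
  induction cs.heckeBasis.mem_span a using Submodule.span_induction with
  | zero => rw [map_zero]; exact Commute.zero_left _
  | mem a ha =>
    obtain ⟨w, rfl⟩ := ha
    rw [heckeBasis_apply, heckeMulLeft_heckeT]
    refine Commute.list_prod_left _ _ fun f hf => ?_
    obtain ⟨i, -, rfl⟩ := List.mem_map.1 hf
    exact cs.commute_heckeLeft_heckeRight i j
  | add a b _ _ ha hb => rw [map_add]; exact ha.add_left hb
  | smul c a _ ha => rw [map_smul]; exact ha.smul_left c

theorem heckeMulLeft_apply_one (a : cs.HeckeAlgebra) :
    cs.heckeMulLeft a (cs.heckeT 1) = a := by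
  have : (LinearMap.applyₗ (cs.heckeT 1)).comp cs.heckeMulLeft =
      (LinearMap.id : cs.HeckeAlgebra →ₗ[ℤ[T;T⁻¹]] _) := by
    refine cs.heckeBasis.ext fun w => ?_
    have h := (cs.exists_isReduced w).choose_spec
    rw [LinearMap.comp_apply, LinearMap.applyₗ_apply_apply, heckeBasis_apply, heckeMulLeft_heckeT,
      heckeLeft_prod_of_isReduced _ h.1, ← h.2, LinearMap.id_apply]
  exact LinearMap.congr_fun this a

theorem heckeMulLeft_one : cs.heckeMulLeft (cs.heckeT 1) = 1 :=
  cs.hecke_end_ext (cs.commute_heckeMulLeft _) (fun _ => Commute.one_left _)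
    (by rw [heckeMulLeft_apply_one]; rfl)

theorem heckeMulLeft_mul (a b : cs.HeckeAlgebra) :
    cs.heckeMulLeft (cs.heckeMulLeft a b) = cs.heckeMulLeft a * cs.heckeMulLeft b :=
  cs.hecke_end_ext (cs.commute_heckeMulLeft _)
    (fun j => (cs.commute_heckeMulLeft a j).mul_left (cs.commute_heckeMulLeft b j))
    (by rw [heckeMulLeft_apply_one, Module.End.mul_apply, heckeMulLeft_apply_one])

noncomputable instance : Ring cs.HeckeAlgebra where
  __ := (inferInstance : AddCommGroup cs.HeckeAlgebra)
  mul a b := cs.heckeMulLeft a b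
  one := cs.heckeT 1
  left_distrib a b c := map_add (cs.heckeMulLeft a) b c
  right_distrib a b c := LinearMap.congr_fun (map_add cs.heckeMulLeft a b) c
  zero_mul a := LinearMap.congr_fun (map_zero cs.heckeMulLeft) a
  mul_zero a := map_zero (cs.heckeMulLeft a)
  mul_assoc a b c := LinearMap.congr_fun (cs.heckeMulLeft_mul a b) c
  one_mul a := LinearMap.congr_fun cs.heckeMulLeft_one a
  mul_one a := cs.heckeMulLeft_apply_one a

theorem hecke_mul_def (a b : cs.HeckeAlgebra) : a * b = cs.heckeMulLeft a b := rfl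

theorem heckeT_one : cs.heckeT 1 = 1 := rfl

noncomputable instance : Algebra ℤ[T;T⁻¹] cs.HeckeAlgebra :=
  Algebra.ofModule (fun r a b => LinearMap.congr_fun (map_smul cs.heckeMulLeft r a) b)
    (fun r a b => map_smul (cs.heckeMulLeft a) r b)

theorem heckeMulLeft_simple (i : B) : cs.heckeMulLeft (cs.heckeT (cs.simple i)) = cs.heckeLeft i :=
  cs.hecke_end_ext (cs.commute_heckeMulLeft _) (fun j => cs.commute_heckeLeft_heckeRight i j)
    (by rw [heckeMulLeft_apply_one,
          heckeLeft_of_not_isLeftDescent _ (cs.not_isLeftDescent_one i), mul_one])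

/-- `T_s T_w = T_{sw}` if `sw > w`. -/
theorem heckeT_simple_mul_of_not_isLeftDescent {i : B} {w : W} (h : ¬ cs.IsLeftDescent w i) :
    cs.heckeT (cs.simple i) * cs.heckeT w = cs.heckeT (cs.simple i * w) := by
  rw [hecke_mul_def, heckeMulLeft_simple, heckeLeft_of_not_isLeftDescent _ h]

/-- `T_s T_w = (q - 1) T_w + q T_{sw}` if `sw < w`, with `q = t ^ 2`. -/
theorem heckeT_simple_mul_of_isLeftDescent {i : B} {w : W} (h : cs.IsLeftDescent w i) :
    cs.heckeT (cs.simple i) * cs.heckeT w = (LaurentPolynomial.T 2 - 1 : ℤ[T;T⁻¹]) • cs.heckeT w +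
        (LaurentPolynomial.T 2 : ℤ[T;T⁻¹]) • cs.heckeT (cs.simple i * w) := by
  rw [hecke_mul_def, heckeMulLeft_simple, heckeLeft_of_isLeftDescent _ h]

end HeckeAlgebra

section KazhdanLusztig

/-- The bar involution `∑ a_w T_w ↦ ∑ ā_w (T_{w⁻¹})⁻¹`, where `a ↦ ā` exchanges `t` and `t⁻¹`. -/
noncomputable def heckeBar (h : cs.HeckeAlgebra) : cs.HeckeAlgebra :=
  (cs.heckeBasis.repr h).sum fun w a =>
    LaurentPolynomial.invert a • Ring.inverse (cs.heckeT w⁻¹)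

/-- The Chevalley-Bruhat order, strict version: `x < y` if `y` is obtained from `x` by successive
multiplication by reflections, the length increasing at each step. -/
def BruhatLT : W → W → Prop :=
  Relation.TransGen fun x y => ∃ r, cs.IsReflection r ∧ y = x * r ∧ cs.length x < cs.length y

/-- `t ^ (-ℓ(w)) ∑_y P_y(t²) T_y`. -/
noncomputable def klSum (w : W) (P : W →₀ ℤ[X]) : cs.HeckeAlgebra :=
  P.sum fun y p =>
    (LaurentPolynomial.T (-(cs.length w : ℤ)) *
      Polynomial.aeval (LaurentPolynomial.T 2 : ℤ[T;T⁻¹]) p) • cs.heckeT y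

/-- The defining properties of the Kazhdan-Lusztig polynomials `y ↦ P_{y,w}`. -/
structure IsKLFamily (w : W) (P : W →₀ ℤ[X]) : Prop where
  le : ∀ y, P y ≠ 0 → y = w ∨ cs.BruhatLT y w
  self : P w = 1
  natDegree_le : ∀ y, cs.BruhatLT y w →
    2 * (P y).natDegree + 1 ≤ cs.length w - cs.length y
  bar_eq : cs.heckeBar (cs.klSum w P) = cs.klSum w P

/-- The Kazhdan-Lusztig polynomials: `klPoly w y` is `P_{y,w}`. The family `y ↦ P_{y,w}` is the
unique one that satisfies `IsKLFamily`. -/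
noncomputable def klPoly (w : W) : W →₀ ℤ[X] := Classical.epsilon (cs.IsKLFamily w)

/-- The Kazhdan-Lusztig basis element `C'_w = t ^ (-ℓ(w)) ∑_{y ≤ w} P_{y,w}(t²) T_y`. -/
noncomputable def klC (w : W) : cs.HeckeAlgebra := cs.klSum w (cs.klPoly w)

/-- `y ≺ w`: one has `y < w`, the difference `ℓ(w) - ℓ(y)` is odd, and the coefficient `μ(y, w)` of
`q ^ ((ℓ(w) - ℓ(y) - 1) / 2)` in `P_{y,w}` is non-zero. -/
def KLPrec (y w : W) : Prop :=
  cs.BruhatLT y w ∧ Odd (cs.length w - cs.length y) ∧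
    (cs.klPoly w y).coeff ((cs.length w - cs.length y - 1) / 2) ≠ 0

/-- The left preorder `x ≤_L y`: there is a chain from `x` to `y` such that any two consecutive
elements `x'`, `y'` of it are joined in the Kazhdan-Lusztig graph (`x' ≺ y'` or `y' ≺ x'`) and the
left descent set of `x'` is not contained in that of `y'`. -/
def LeftCellLE : W → W → Prop :=
  Relation.ReflTransGen fun x y =>
    (cs.KLPrec x y ∨ cs.KLPrec y x) ∧ ∃ i, cs.IsLeftDescent x i ∧ ¬ cs.IsLeftDescent y i

/-- Left cells are the equivalence classes of the left preorder. -/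
def IsLeftCell (C : Set W) : Prop :=
  ∃ w, C = {x | cs.LeftCellLE x w ∧ cs.LeftCellLE w x}

/-- The left ideal of the Hecke algebra spanned by the `C'_y` with `y ≤_L w` for some `w ∈ C`. -/
noncomputable def leftCellIdeal (C : Set W) : Submodule cs.HeckeAlgebra cs.HeckeAlgebra :=
  Submodule.span cs.HeckeAlgebra (cs.klC '' {y | ∃ w ∈ C, cs.LeftCellLE y w})

/-- The left ideal of the Hecke algebra spanned by the `C'_y` with `y ≤_L w` for some `w ∈ C`, and
`y ∉ C`. -/
noncomputable def leftCellIdealLT (C : Set W) : Submodule cs.HeckeAlgebra cs.HeckeAlgebra :=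
  Submodule.span cs.HeckeAlgebra (cs.klC '' {y | (∃ w ∈ C, cs.LeftCellLE y w) ∧ y ∉ C})

/-- The left cell module over `ℤ[t, t⁻¹]`, a quotient of left ideals of the Hecke algebra. -/
abbrev LeftCellModule (C : Set W) : Type _ :=
  cs.leftCellIdeal C ⧸ (cs.leftCellIdealLT C).comap (cs.leftCellIdeal C).subtype

/-- The Kazhdan-Lusztig basis vector of the left cell module indexed by `x ∈ C`: the class
of `C'_x`. -/
noncomputable def leftCellVec (C : Set W) (x : C) : cs.LeftCellModule C :=
  Submodule.Quotient.mk ⟨cs.klC x, Submodule.subset_span ⟨x, ⟨x, x.2, .refl⟩, rfl⟩⟩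

variable (K : Type*) [CommRing K] [Algebra ℤ[T;T⁻¹] K]

/-- The left cell representation with coefficients extended to `K`. -/
noncomputable def leftCellRep (C : Set W) :
    cs.HeckeAlgebra →ₐ[ℤ[T;T⁻¹]] Module.End K (K ⊗[ℤ[T;T⁻¹]] cs.LeftCellModule C) :=
  (Module.End.baseChangeHom ℤ[T;T⁻¹] K (cs.LeftCellModule C)).comp
    (Algebra.lsmul ℤ[T;T⁻¹] ℤ[T;T⁻¹] (cs.LeftCellModule C))

/-- The Kazhdan-Lusztig basis vector `c_x` of the left cell representation over `K`. -/
noncomputable def leftCellBasisVec (C : Set W) (x : C) : K ⊗[ℤ[T;T⁻¹]] cs.LeftCellModule C :=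
  1 ⊗ₜ cs.leftCellVec C x

end KazhdanLusztig

end CoxeterSystem

/-!
A symmetric form is determined by its values on the spanning vectors `c_x`, so invariance under
`C'_s` has to be checked on pairs `(c_x, c_w)` only. If `s x < x`, then `C'_s c_x = (t + t⁻¹) c_x`;
if `s w > w`, then `C'_s c_w` is a combination of vectors `c_y` with `s y < y`. For `s x < x` and
`s w < w` invariance is automatic, for `s x < x` and `s w > w` it is the given equation, and for
`s x > x` and `s w > w` the given equations, applied to the constituents of `C'_s c_x` and of
`C'_s c_w`, show that both `(t + t⁻¹) ⟨C'_s c_x, c_w⟩` and `(t + t⁻¹) ⟨c_x, C'_s c_w⟩` equal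
`⟨C'_s c_x, C'_s c_w⟩`; the non-zero factor cancels. This is the linear algebra of
`LinearMap.BilinForm.invariant_iff_of_eigenvectors`. The second part follows because
`T_s = t C'_s - 1` and `T_y` is a product of `T_s` along a reduced word.

The input is the multiplication of the Kazhdan-Lusztig basis by `C'_s`
(`klGen_mul_klC_of_isLeftDescent`, `klGen_mul_klC_of_not_isLeftDescent`), which is proved together
with the existence of that basis (`isKLFamily_klPoly`), by induction on the length. For `s w > w`
the element `C'_s C'_w - ∑ μ(z, w) C'_z`, the sum being over `z ≺ w` with `s z < z`, is
bar-invariant, and the correction terms remove exactly the coefficients that violate the degree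
bound (`natDegree_klStep_le`). Its support lies below `s w` by the lifting property of the Bruhat
order, a consequence of the strong exchange condition. It equals `C'_{sw}`, because a bar-invariant
element with coefficients in `t⁻¹ ℤ[t⁻¹]` with respect to `t ^ (-ℓ(y)) T_y` vanishes
(`eq_zero_of_heckeBar_eq`). The elements `C'_y` that occur in `C'_s C'_w` satisfy `y ≤_L w`, so the
left ideals that define the left cell module are spanned by their `C'_y` over `ℤ[t, t⁻¹]`, and the
`c_x` span the left cell module (`span_leftCellVec`).
-/

namespace CoxeterSystem

variable {B W : Type*} [Group W] {M : CoxeterMatrix B} (cs : CoxeterSystem M W)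

/-! ### The strong exchange condition and the lifting property of the Bruhat order -/

section Bruhat

open scoped Classical in
theorem lift_reflAct_wordProd (ω : List B) (t : W) (e : ZMod 2) :
    cs.lift ⟨cs.reflAct, cs.reflAct_liftable⟩ (cs.wordProd ω) (t, e) =
      (cs.wordProd ω * t * (cs.wordProd ω)⁻¹, e + ((cs.rightInvSeq ω).count t : ZMod 2)) := by
  rw [← reflAct_prod_eq, reflAct_word]

/-- A reflection `t`, acting on itself, changes the parity: `t` occurs an odd number of times in the
right inversion sequence of any word for `t`. -/
theorem lift_reflAct_self {t : W} (ht : cs.IsReflection t) :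
    cs.lift ⟨cs.reflAct, cs.reflAct_liftable⟩ t (t, 0) = (t, 1) := by
  classical
  obtain ⟨u, i, rfl⟩ := ht
  obtain ⟨ω, -, rfl⟩ := cs.exists_isReduced u
  obtain ⟨ω', -, hω'⟩ := cs.exists_isReduced (cs.wordProd ω)⁻¹
  have h1 := cs.lift_reflAct_wordProd ω' (cs.wordProd ω * cs.simple i * (cs.wordProd ω)⁻¹) 0
  rw [← hω'] at h1
  set a : ZMod 2 := 0 + ((cs.rightInvSeq ω').count
    (cs.wordProd ω * cs.simple i * (cs.wordProd ω)⁻¹) : ZMod 2) with ha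
  have e1 : (cs.wordProd ω)⁻¹ * (cs.wordProd ω * cs.simple i * (cs.wordProd ω)⁻¹) *
      (cs.wordProd ω)⁻¹⁻¹ = cs.simple i := by group
  rw [e1] at h1
  have h2 := cs.lift_reflAct_wordProd ω (cs.simple i) a
  have h3 : a + ((cs.rightInvSeq ω).count (cs.simple i) : ZMod 2) = 0 := by
    have h4 : cs.lift ⟨cs.reflAct, cs.reflAct_liftable⟩
        (cs.wordProd ω * (cs.wordProd ω)⁻¹)
          (cs.wordProd ω * cs.simple i * (cs.wordProd ω)⁻¹, 0) =
        (cs.wordProd ω * cs.simple i * (cs.wordProd ω)⁻¹, 0) := by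
      rw [mul_inv_cancel, map_one, end_one_apply]
    rw [map_mul, end_mul_apply, h1, h2] at h4
    exact congrArg Prod.snd h4
  rw [map_mul, map_mul, end_mul_apply, end_mul_apply, h1, lift_apply_simple, reflAct_apply,
    lift_reflAct_wordProd]
  refine Prod.ext (by simp) ?_
  simp only [if_true, simple_mul_simple_self, one_mul]
  rw [add_right_comm, h3, zero_add]

/-- The strong exchange condition: every right inversion of the product of a word occurs in the
right inversion sequence of the word. -/
theorem mem_rightInvSeq_of_isRightInversion {ω : List B} {t : W}
    (h : cs.IsRightInversion (cs.wordProd ω) t) : t ∈ cs.rightInvSeq ω := by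
  classical
  by_contra hne
  obtain ⟨ω', hω', hw⟩ := cs.exists_isReduced (cs.wordProd ω * t)
  have h1 := cs.lift_reflAct_wordProd ω' t 0
  rw [← hw, map_mul, end_mul_apply, lift_reflAct_self _ h.1, lift_reflAct_wordProd,
    List.count_eq_zero_of_not_mem hne] at h1
  have hmem : t ∈ cs.rightInvSeq ω' := by
    by_contra hne'
    rw [List.count_eq_zero_of_not_mem hne'] at h1
    simpa using congrArg Prod.snd h1
  have h2 := (cs.isRightInversion_of_mem_rightInvSeq hω' hmem).2
  rw [← hw, mul_assoc, h.1.mul_self, mul_one] at h2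
  exact lt_asymm h2 h.2

/-- One step up in the Bruhat order: `y = x r` for a reflection `r`, and `ℓ(x) < ℓ(y)`. The strict
Bruhat order is the transitive closure. -/
def BruhatStep (x y : W) : Prop :=
  ∃ r, cs.IsReflection r ∧ y = x * r ∧ cs.length x < cs.length y

/-- The Bruhat order, non-strict version. -/
def BruhatLE : W → W → Prop := Relation.ReflTransGen cs.BruhatStep

variable {cs}

theorem bruhatLE_iff {x y : W} : cs.BruhatLE x y ↔ x = y ∨ cs.BruhatLT x y := by
  rw [BruhatLE, Relation.reflTransGen_iff_eq_or_transGen, eq_comm]; rfl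

theorem BruhatLT.length_lt {x y : W} (h : cs.BruhatLT x y) : cs.length x < cs.length y := by
  induction h with
  | single h => exact h.choose_spec.2.2
  | tail _ h ih => exact ih.trans h.choose_spec.2.2

theorem bruhatStep_simple_mul {w : W} {i : B} (h : ¬ cs.IsLeftDescent w i) :
    cs.BruhatStep w (cs.simple i * w) := by
  refine ⟨w⁻¹ * cs.simple i * w, ?_, by group, ?_⟩
  · simpa using (cs.isReflection_simple i).conj w⁻¹
  · rw [(cs.not_isLeftDescent_iff).1 h]; omega

theorem BruhatStep.simple_mul {x y : W} (h : cs.BruhatStep x y) (i : B) :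
    cs.BruhatLE (cs.simple i * x) y ∨ cs.BruhatLE (cs.simple i * x) (cs.simple i * y) := by
  obtain ⟨r, hr, hy, hl⟩ := h
  by_cases hx : cs.IsLeftDescent x i
  · have := bruhatStep_simple_mul (cs.isLeftDescent_iff_not_isLeftDescent_mul.1 hx)
    rw [simple_mul_simple_cancel_left] at this
    exact Or.inl (.head this (.single ⟨r, hr, hy, hl⟩))
  by_cases hlt : cs.length (cs.simple i * x) < cs.length (cs.simple i * y)
  · exact Or.inr (.single ⟨r, hr, by rw [hy, mul_assoc], hlt⟩)
  -- Otherwise `y` covers `x` and `s y < y`, and the strong exchange condition gives `s x = y`.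
  have hxl := (cs.not_isLeftDescent_iff).1 hx
  have hne : cs.length (cs.simple i * y) ≠ cs.length (cs.simple i * x) := by
    rw [hy, ← mul_assoc]; exact hr.length_mul_left_ne _
  have hyl := cs.length_simple_mul y i
  obtain ⟨ω, hω, hω'⟩ := cs.exists_isReduced (cs.simple i * y)
  have hyω : y = cs.wordProd (i :: ω) := by rw [wordProd_cons, ← hω']; simp
  have hxy : x = y * r := by rw [hy, mul_assoc, hr.mul_self, mul_one]
  have hmem : r ∈ cs.rightInvSeq (i :: ω) :=
    cs.mem_rightInvSeq_of_isRightInversion ⟨hr, by rw [← hyω, ← hxy]; exact hl⟩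
  obtain ⟨k, hk, hk'⟩ := List.getElem_of_mem hmem
  have hx' : x = cs.wordProd ((i :: ω).eraseIdx k) := by
    rw [← wordProd_mul_getD_rightInvSeq, List.getD_eq_getElem _ _ hk, hk', hxy, hyω]
  have hlen := hω.eq
  rw [← hω'] at hlen
  cases k with
  | zero =>
    left
    rw [hx', List.eraseIdx_cons_zero, ← hω', simple_mul_simple_cancel_left]
    exact .refl
  | succ k =>
    exfalso
    have hk1 : k < ω.length := by simpa using hk
    rw [List.eraseIdx_cons_succ, wordProd_cons] at hx'
    have h1 := cs.length_wordProd_le (ω.eraseIdx k)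
    have h2 : cs.wordProd (ω.eraseIdx k) = cs.simple i * x := by rw [hx']; simp
    rw [h2, List.length_eraseIdx_of_lt hk1] at h1
    omega

theorem BruhatLE.simple_mul {x w : W} (h : cs.BruhatLE x w) (i : B) :
    cs.BruhatLE (cs.simple i * x) w ∨ cs.BruhatLE (cs.simple i * x) (cs.simple i * w) := by
  induction h using Relation.ReflTransGen.head_induction_on with
  | refl => exact Or.inr .refl
  | head hxy hyw ih =>
    rcases hxy.simple_mul i with h | h
    · exact Or.inl (Relation.ReflTransGen.trans h hyw)
    · exact ih.imp (Relation.ReflTransGen.trans h) (Relation.ReflTransGen.trans h)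

theorem BruhatLE.le_simple_mul {x w : W} {i : B} (h : cs.BruhatLE x w)
    (hw : ¬ cs.IsLeftDescent w i) : cs.BruhatLE x (cs.simple i * w) :=
  Relation.ReflTransGen.tail h (bruhatStep_simple_mul hw)

/-- The lifting property: if `x ≤ w` and `s w > w`, then `s x ≤ s w`. -/
theorem BruhatLE.simple_mul_le_simple_mul {x w : W} {i : B} (h : cs.BruhatLE x w)
    (hw : ¬ cs.IsLeftDescent w i) : cs.BruhatLE (cs.simple i * x) (cs.simple i * w) :=
  (h.simple_mul i).elim (fun h => h.le_simple_mul hw) id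

end Bruhat

/-! ### The bar involution -/

section Bar

open LaurentPolynomial (T invert)

theorem heckeT_simple_mul_self (i : B) : cs.heckeT (cs.simple i) * cs.heckeT (cs.simple i) =
    (T 2 - 1 : ℤ[T;T⁻¹]) • cs.heckeT (cs.simple i) + (T 2 : ℤ[T;T⁻¹]) • 1 := by
  rw [heckeT_simple_mul_of_isLeftDescent _ (by simp [IsLeftDescent]), simple_mul_simple_self,
    heckeT_one]

theorem T_two_mul_T_neg_two : (T 2 * T (-2) : ℤ[T;T⁻¹]) = 1 := by
  rw [← LaurentPolynomial.T_add]; rfl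

/-- The inverse of `T_s`, that is `T_s⁻¹ = q⁻¹ T_s + q⁻¹ - 1`. -/
noncomputable def heckeTInv (i : B) : cs.HeckeAlgebra :=
  (T (-2) : ℤ[T;T⁻¹]) • cs.heckeT (cs.simple i) + (T (-2) - 1 : ℤ[T;T⁻¹]) • 1

theorem heckeT_mul_heckeTInv (i : B) : cs.heckeT (cs.simple i) * cs.heckeTInv i = 1 := by
  rw [heckeTInv, mul_add, mul_smul_comm, mul_smul_comm, heckeT_simple_mul_self, mul_one]
  match_scalars
  · linear_combination T_two_mul_T_neg_two
  · linear_combination T_two_mul_T_neg_two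

theorem heckeTInv_mul_heckeT (i : B) : cs.heckeTInv i * cs.heckeT (cs.simple i) = 1 := by
  rw [heckeTInv, add_mul, smul_mul_assoc, smul_mul_assoc, heckeT_simple_mul_self, one_mul]
  match_scalars
  · linear_combination T_two_mul_T_neg_two
  · linear_combination T_two_mul_T_neg_two

/-- `T_s` as a unit of the Hecke algebra. -/
noncomputable def heckeTUnit (i : B) : cs.HeckeAlgebraˣ :=
  ⟨cs.heckeT (cs.simple i), cs.heckeTInv i, cs.heckeT_mul_heckeTInv i, cs.heckeTInv_mul_heckeT i⟩

variable {cs} in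
theorem heckeT_mul_simple_of_not_isRightDescent {j : B} {w : W} (h : ¬ cs.IsRightDescent w j) :
    cs.heckeT w * cs.heckeT (cs.simple j) = cs.heckeT (w * cs.simple j) := by
  have h1 := (cs.commute_heckeMulLeft (cs.heckeT w) j).eq
  have h2 := LinearMap.congr_fun h1 (cs.heckeT 1)
  rw [Module.End.mul_apply, Module.End.mul_apply, heckeMulLeft_apply_one,
    heckeRight_of_not_isRightDescent _ (cs.not_isRightDescent_one j), one_mul,
    heckeRight_of_not_isRightDescent _ h] at h2
  exact h2

theorem isUnit_heckeT (w : W) : IsUnit (cs.heckeT w) := by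
  induction hn : cs.length w generalizing w with
  | zero => rw [cs.length_eq_zero_iff.1 hn, heckeT_one]; exact isUnit_one
  | succ n ih =>
    have hw : w ≠ 1 := by rintro rfl; simp at hn
    obtain ⟨j, hj⟩ := cs.exists_leftDescent_of_ne_one hw
    have hl := cs.isLeftDescent_iff.1 hj
    have := cs.heckeT_simple_mul_of_not_isLeftDescent
      (cs.isLeftDescent_iff_not_isLeftDescent_mul.1 hj)
    rw [simple_mul_simple_cancel_left] at this
    rw [← this]
    exact (cs.heckeTUnit j).isUnit.mul (ih _ (by omega))

/-- The elements `(T_{w⁻¹})⁻¹` satisfy the same recursion as the `T_w`, with `T_s⁻¹` for `T_s`. -/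
theorem inverse_heckeT_inv_simple_mul {i : B} {w : W} (h : ¬ cs.IsLeftDescent w i) :
    Ring.inverse (cs.heckeT (cs.simple i * w)⁻¹) =
      cs.heckeTInv i * Ring.inverse (cs.heckeT w⁻¹) := by
  have h' : ¬ cs.IsRightDescent w⁻¹ i := by rwa [isRightDescent_inv_iff]
  rw [mul_inv_rev, inv_simple, ← heckeT_mul_simple_of_not_isRightDescent h']
  obtain ⟨u, hu⟩ := cs.isUnit_heckeT w⁻¹
  have hi : cs.heckeT (cs.simple i) = cs.heckeTUnit i := rfl
  rw [← hu, hi, ← Units.val_mul, Ring.inverse_unit, Ring.inverse_unit, mul_inv_rev, Units.val_mul]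
  rfl

theorem heckeBar_add (g h : cs.HeckeAlgebra) :
    cs.heckeBar (g + h) = cs.heckeBar g + cs.heckeBar h := by
  rw [heckeBar, map_add, Finsupp.sum_add_index'] <;> simp [heckeBar, add_smul]

theorem heckeBar_smul (a : ℤ[T;T⁻¹]) (h : cs.HeckeAlgebra) :
    cs.heckeBar (a • h) = invert a • cs.heckeBar h := by
  rw [heckeBar, map_smul, Finsupp.sum_smul_index (by simp), heckeBar, Finsupp.smul_sum]
  simp [mul_smul]

theorem heckeBar_heckeT (w : W) :
    cs.heckeBar (cs.heckeT w) = Ring.inverse (cs.heckeT w⁻¹) := by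
  rw [heckeBar, ← heckeBasis_apply, Module.Basis.repr_self, Finsupp.sum_single_index] <;>
    simp

theorem heckeBar_one : cs.heckeBar 1 = 1 := by
  rw [← heckeT_one, heckeBar_heckeT, inv_one, heckeT_one, Ring.inverse_one]

/-- The bar involution as a semilinear map over the exchange of `t` and `t⁻¹`. -/
noncomputable def heckeBarₗ :
    cs.HeckeAlgebra →ₛₗ[(invert : ℤ[T;T⁻¹] ≃ₐ[ℤ] ℤ[T;T⁻¹]).toRingEquiv.toRingHom]
      cs.HeckeAlgebra where
  toFun := cs.heckeBar
  map_add' := cs.heckeBar_add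
  map_smul' := cs.heckeBar_smul

theorem heckeBar_zero : cs.heckeBar 0 = 0 := cs.heckeBarₗ.map_zero

theorem heckeBar_simple_mul (i : B) (h : cs.HeckeAlgebra) :
    cs.heckeBar (cs.heckeT (cs.simple i) * h) = cs.heckeTInv i * cs.heckeBar h := by
  induction cs.heckeBasis.mem_span h using Submodule.span_induction with
  | zero => rw [mul_zero, heckeBar_zero, mul_zero]
  | add a b _ _ ha hb => rw [mul_add, heckeBar_add, ha, hb, heckeBar_add, mul_add]
  | smul c a _ ha => rw [mul_smul_comm, heckeBar_smul, ha, heckeBar_smul, mul_smul_comm]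
  | mem a ha =>
    obtain ⟨w, rfl⟩ := ha
    rw [heckeBasis_apply]
    by_cases hw : cs.IsLeftDescent w i
    · have hw' := cs.isLeftDescent_iff_not_isLeftDescent_mul.1 hw
      have h1 := cs.inverse_heckeT_inv_simple_mul hw'
      rw [simple_mul_simple_cancel_left] at h1
      rw [heckeT_simple_mul_of_isLeftDescent _ hw, heckeBar_add, heckeBar_smul, heckeBar_smul,
        heckeBar_heckeT, heckeBar_heckeT, h1]
      have h2 : cs.heckeTInv i * cs.heckeTInv i =
          (T (-2) - 1 : ℤ[T;T⁻¹]) • cs.heckeTInv i + (T (-2) : ℤ[T;T⁻¹]) • 1 := by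
        nth_rw 1 [heckeTInv]
        rw [add_mul, smul_mul_assoc, smul_mul_assoc, heckeT_mul_heckeTInv, one_mul, add_comm]
      rw [← mul_assoc, h2, add_mul, smul_mul_assoc, smul_mul_assoc, one_mul]
      simp
    · rw [heckeT_simple_mul_of_not_isLeftDescent _ hw, heckeBar_heckeT,
        inverse_heckeT_inv_simple_mul _ hw, heckeBar_heckeT]

/-- The element `t⁻¹ (T_s + 1)` of the Hecke algebra, which is `C'_s`. -/
noncomputable def klGen (i : B) : cs.HeckeAlgebra :=
  (T (-1) : ℤ[T;T⁻¹]) • (cs.heckeT (cs.simple i) + 1)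

theorem heckeT_simple_eq (i : B) :
    cs.heckeT (cs.simple i) = (T 1 : ℤ[T;T⁻¹]) • cs.klGen i - 1 := by
  rw [klGen, smul_smul, ← LaurentPolynomial.T_add]; simp

theorem heckeBar_klGen_mul (i : B) (h : cs.HeckeAlgebra) :
    cs.heckeBar (cs.klGen i * h) = cs.klGen i * cs.heckeBar h := by
  have h1 : cs.klGen i = (T 1 : ℤ[T;T⁻¹]) • (cs.heckeTInv i + 1) := by
    have e : (T 1 * T (-2) : ℤ[T;T⁻¹]) = T (-1) := by rw [← LaurentPolynomial.T_add]; rfl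
    rw [klGen, heckeTInv]
    match_scalars
    · linear_combination -e
    · linear_combination -e
  rw [klGen, smul_mul_assoc, add_mul, one_mul, heckeBar_smul, heckeBar_add, heckeBar_simple_mul,
    ← klGen, h1, smul_mul_assoc, add_mul, one_mul]
  simp

theorem klGen_mul_self (i : B) :
    cs.klGen i * cs.klGen i = (T 1 + T (-1) : ℤ[T;T⁻¹]) • cs.klGen i := by
  have e : (T (-1) * T (2) : ℤ[T;T⁻¹]) = T 1 := by rw [← LaurentPolynomial.T_add]; rfl
  rw [klGen, smul_mul_smul_comm, mul_add, add_mul, heckeT_simple_mul_self, mul_one, one_mul]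
  match_scalars
  · linear_combination T (-1) * e
  · linear_combination T (-1) * e

/-! ### Coefficients and uniqueness of bar-invariant elements -/

open scoped Classical in
theorem repr_heckeT_simple_mul (i : B) (h : cs.HeckeAlgebra) (x : W) :
    cs.heckeBasis.repr (cs.heckeT (cs.simple i) * h) x =
      if cs.IsLeftDescent x i then
        cs.heckeBasis.repr h (cs.simple i * x) + (T 2 - 1) * cs.heckeBasis.repr h x
      else T 2 * cs.heckeBasis.repr h (cs.simple i * x) := by
  induction cs.heckeBasis.mem_span h using Submodule.span_induction with
  | zero => simp
  | add a b _ _ ha hb =>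
    rw [mul_add, map_add, Finsupp.add_apply, ha, hb, map_add, Finsupp.add_apply, Finsupp.add_apply]
    split_ifs <;> ring
  | smul c a _ ha =>
    rw [mul_smul_comm, map_smul, Finsupp.smul_apply, ha, map_smul, Finsupp.smul_apply,
      Finsupp.smul_apply]
    simp only [smul_eq_mul]
    split_ifs <;> ring
  | mem a ha =>
    obtain ⟨w, rfl⟩ := ha
    have key : ∀ y, cs.heckeBasis.repr (cs.heckeT y) = Finsupp.single y 1 := fun y => by
      rw [← heckeBasis_apply, Module.Basis.repr_self]
    rw [heckeBasis_apply]
    have hiff : w = cs.simple i * x ↔ cs.simple i * w = x := by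
      constructor
      · rintro rfl; simp
      · rintro rfl; simp
    by_cases hw : cs.IsLeftDescent w i
    · rw [heckeT_simple_mul_of_isLeftDescent _ hw]
      simp only [map_add, map_smul, key, Finsupp.add_apply, Finsupp.smul_apply,
        Finsupp.single_apply, hiff, smul_eq_mul]
      by_cases h1 : cs.simple i * w = x
      · subst h1
        have := cs.isLeftDescent_iff_not_isLeftDescent_mul.1 hw
        have h2 : w ≠ cs.simple i * w := fun h => this (h ▸ hw)
        simp [this, h2]
      · by_cases h2 : w = x
        · subst h2; simp [hw, -mul_eq_right, h1]
        · simp [h1, h2]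
    · rw [heckeT_simple_mul_of_not_isLeftDescent _ hw]
      simp only [key, Finsupp.single_apply, hiff]
      by_cases h1 : cs.simple i * w = x
      · subst h1
        have h2 : cs.IsLeftDescent (cs.simple i * w) i := by
          rwa [cs.isLeftDescent_iff_not_isLeftDescent_mul, simple_mul_simple_cancel_left]
        have h3 : w ≠ cs.simple i * w := fun h => hw (h ▸ h2)
        simp [h2, h3]
      · by_cases h2 : w = x
        · subst h2; simp [hw, -mul_eq_right, h1]
        · simp [h1, h2]

open scoped Classical in
theorem repr_klGen_mul (i : B) (h : cs.HeckeAlgebra) (x : W) :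
    cs.heckeBasis.repr (cs.klGen i * h) x =
      T (-1) * if cs.IsLeftDescent x i then
        cs.heckeBasis.repr h (cs.simple i * x) + T 2 * cs.heckeBasis.repr h x
      else T 2 * cs.heckeBasis.repr h (cs.simple i * x) + cs.heckeBasis.repr h x := by
  rw [klGen, smul_mul_assoc, map_smul, Finsupp.smul_apply, add_mul, one_mul, map_add,
    Finsupp.add_apply, repr_heckeT_simple_mul, smul_eq_mul]
  split_ifs <;> ring

open scoped Classical in
/-- The bar involution is triangular for the length: the image of `T_z` is `q ^ (-ℓ(z)) T_z` plus a
combination of shorter basis elements. -/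
theorem repr_heckeBar_heckeT {z y : W} (h : cs.length z ≤ cs.length y) :
    cs.heckeBasis.repr (cs.heckeBar (cs.heckeT z)) y =
      if z = y then T (-2 * cs.length z) else 0 := by
  induction hn : cs.length z generalizing z y with
  | zero =>
    rw [cs.length_eq_zero_iff.1 hn, heckeBar_heckeT, inv_one, heckeT_one, Ring.inverse_one,
      ← heckeT_one, ← heckeBasis_apply, Module.Basis.repr_self, Finsupp.single_apply]
    simp
  | succ n ih =>
    have hz : z ≠ 1 := by rintro rfl; simp at hn
    obtain ⟨i, hi⟩ := cs.exists_leftDescent_of_ne_one hz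
    have hl := cs.isLeftDescent_iff.1 hi
    obtain ⟨u, rfl⟩ : ∃ u, z = cs.simple i * u := ⟨cs.simple i * z, by simp⟩
    have hi' := cs.isLeftDescent_iff_not_isLeftDescent_mul.1 hi
    rw [simple_mul_simple_cancel_left] at hi' hl
    have hu : cs.length u = n := by omega
    rw [← heckeT_simple_mul_of_not_isLeftDescent _ hi', heckeBar_simple_mul, heckeTInv, add_mul,
      smul_mul_assoc, smul_mul_assoc, one_mul, map_add, Finsupp.add_apply, map_smul, map_smul,
      Finsupp.smul_apply, Finsupp.smul_apply, repr_heckeT_simple_mul]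
    have hyl := cs.length_simple_mul y i
    have hiff : u = cs.simple i * y ↔ cs.simple i * u = y := by
      constructor
      · rintro rfl; simp
      · rintro rfl; simp
    have h1 : cs.heckeBasis.repr (cs.heckeBar (cs.heckeT u)) y = 0 := by
      rw [ih (by omega) hu, if_neg]
      rintro rfl; omega
    have h2 := ih (z := u) (y := cs.simple i * y) (by omega) hu
    rw [h1, h2]
    simp only [hiff, smul_eq_mul, mul_zero, add_zero]
    by_cases hy : cs.simple i * u = y
    · rw [if_pos hy, if_pos hy, if_pos (hy ▸ hi), ← LaurentPolynomial.T_add]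
      congr 1; push_cast; ring
    · simp [hy]

/-- A bar-invariant element all of whose coefficients in the normalized basis `t ^ (-ℓ(y)) T_y` lie
in `t⁻¹ ℤ[t⁻¹]` is zero. -/
theorem eq_zero_of_heckeBar_eq {h : cs.HeckeAlgebra} (hbar : cs.heckeBar h = h)
    (hneg : ∀ y, ∀ n : ℤ, 0 ≤ n → (T (cs.length y) * cs.heckeBasis.repr h y).coeff n = 0) :
    h = 0 := by
  classical
  by_contra hne
  have hs : (cs.heckeBasis.repr h).support.Nonempty := by
    rwa [Finsupp.support_nonempty_iff, Ne, LinearEquiv.map_eq_zero_iff]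
  obtain ⟨y, hy, hmax⟩ := Finset.exists_max_image _ cs.length hs
  have h1 : cs.heckeBasis.repr (cs.heckeBar h) y =
      invert (cs.heckeBasis.repr h y) * T (-2 * cs.length y) := by
    rw [heckeBar, Finsupp.sum, map_sum, Finsupp.finsetSum_apply, Finset.sum_eq_single y]
    · rw [← heckeBar_heckeT, map_smul, Finsupp.smul_apply, repr_heckeBar_heckeT _ le_rfl,
        if_pos rfl, smul_eq_mul]
    · intro z hz hzy
      rw [← heckeBar_heckeT, map_smul, Finsupp.smul_apply, repr_heckeBar_heckeT _ (hmax z hz),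
        if_neg hzy, smul_zero]
    · exact fun h => (h hy).elim
  rw [hbar] at h1
  set a := T (cs.length y) * cs.heckeBasis.repr h y with ha
  have h2 : a = invert a := by
    rw [ha, map_mul, LaurentPolynomial.invert_T]
    nth_rw 1 [h1]
    rw [mul_left_comm, ← LaurentPolynomial.T_add, mul_comm]
    congr 2; ring
  have h3 : a = 0 := by
    ext n
    rcases le_total 0 n with hn | hn
    · exact hneg y n hn
    · rw [h2, LaurentPolynomial.invert_apply]
      exact hneg y (-n) (by omega)
  rw [ha, (LaurentPolynomial.isUnit_T _).mul_right_eq_zero] at h3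
  exact (Finsupp.mem_support_iff.1 hy) h3

end Bar

/-! ### Existence and uniqueness of the Kazhdan-Lusztig basis -/

section KLBasis

open LaurentPolynomial (T)

theorem repr_klSum (w : W) (P : W →₀ ℤ[X]) (y : W) : cs.heckeBasis.repr (cs.klSum w P) y =
    T (-(cs.length w : ℤ)) * Polynomial.aeval (T 2 : ℤ[T;T⁻¹]) (P y) := by
  classical
  have key : ∀ y, cs.heckeBasis.repr (cs.heckeT y) = Finsupp.single y 1 := fun y => by
    rw [← heckeBasis_apply, Module.Basis.repr_self]
  rw [klSum, Finsupp.sum, map_sum, Finsupp.finsetSum_apply]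
  simp only [map_smul, key, Finsupp.smul_apply, Finsupp.single_apply, smul_eq_mul, mul_ite,
    mul_one, mul_zero]
  rw [Finset.sum_ite_eq']
  split_ifs with h
  · rfl
  · rw [Finsupp.notMem_support_iff.1 h, map_zero, mul_zero]

/-- A polynomial in `t²`, multiplied by a sufficiently negative power of `t`, has only negative
powers of `t`. -/
theorem coeff_T_mul_aeval_eq_zero {k : ℤ} {p : ℤ[X]} (hk : k + 2 * p.natDegree < 0) {n : ℤ}
    (hn : 0 ≤ n) : (T k * Polynomial.aeval (T 2 : ℤ[T;T⁻¹]) p).coeff n = 0 := by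
  rw [Polynomial.aeval_eq_sum_range, Finset.mul_sum, AddMonoidAlgebra.coeff_sum,
    Finsupp.finsetSum_apply]
  refine Finset.sum_eq_zero fun j hj => ?_
  rw [LaurentPolynomial.T_pow, mul_smul_comm, ← LaurentPolynomial.T_add,
    AddMonoidAlgebra.coeff_smul, Finsupp.smul_apply, LaurentPolynomial.T_apply, if_neg, smul_zero]
  rw [Finset.mem_range] at hj
  omega

variable {cs}

theorem IsKLFamily.coeff_ne_zero {w : W} {P : W →₀ ℤ[X]} (h : cs.IsKLFamily w P) {y : W} {n : ℕ}
    (hn : (P y).coeff n ≠ 0) :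
    (y = w ∧ n = 0) ∨ (cs.BruhatLT y w ∧ 2 * n + 1 + cs.length y ≤ cs.length w) := by
  rcases h.le y (fun h0 => hn (by rw [h0, Polynomial.coeff_zero])) with rfl | hlt
  · rw [h.self, Polynomial.coeff_one] at hn
    exact Or.inl ⟨rfl, by_contra fun h0 => hn (if_neg h0)⟩
  · have h1 := h.natDegree_le y hlt
    have h2 := Polynomial.le_natDegree_of_ne_zero hn
    have := hlt.length_lt
    exact Or.inr ⟨hlt, by omega⟩

theorem IsKLFamily.bruhatLE {w : W} {P : W →₀ ℤ[X]} (h : cs.IsKLFamily w P) {y : W}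
    (hy : P y ≠ 0) : cs.BruhatLE y w := bruhatLE_iff.2 (h.le y hy)

theorem BruhatLE.length_le {x y : W} (h : cs.BruhatLE x y) : cs.length x ≤ cs.length y :=
  (bruhatLE_iff.1 h).elim (fun h => h ▸ le_rfl) fun h => h.length_lt.le

theorem IsKLFamily.klSum_eq {w : W} {P P' : W →₀ ℤ[X]} (h : cs.IsKLFamily w P)
    (h' : cs.IsKLFamily w P') : cs.klSum w P = cs.klSum w P' := by
  rw [← sub_eq_zero]
  refine cs.eq_zero_of_heckeBar_eq ?_ fun y n hn => ?_
  · exact (map_sub cs.heckeBarₗ _ _).trans (congrArg₂ _ h.bar_eq h'.bar_eq)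
  rw [map_sub, Finsupp.sub_apply, repr_klSum, repr_klSum, mul_sub, ← mul_assoc, ← mul_assoc,
    ← LaurentPolynomial.T_add]
  have key : ∀ {P : W →₀ ℤ[X]}, cs.IsKLFamily w P → y ≠ w →
      (T ((cs.length y : ℤ) + -(cs.length w : ℤ)) *
        Polynomial.aeval (T 2 : ℤ[T;T⁻¹]) (P y)).coeff n = 0 := by
    intro P h hy
    by_cases h0 : P y = 0
    · rw [h0, map_zero, mul_zero]; rfl
    have hlt := (h.le y h0).resolve_left hy
    have := hlt.length_lt
    have := h.natDegree_le y hlt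
    exact coeff_T_mul_aeval_eq_zero (by omega) hn
  by_cases hy : y = w
  · subst hy
    rw [h.self, h'.self, sub_self]; rfl
  · rw [AddMonoidAlgebra.coeff_sub, Finsupp.sub_apply, key h hy, key h' hy, sub_zero]

variable (cs)

theorem not_bruhatLT_one (y : W) : ¬ cs.BruhatLT y 1 := fun h => by
  simpa using h.length_lt

theorem isKLFamily_one : cs.IsKLFamily 1 (Finsupp.single 1 1) where
  le y hy := Or.inl (by
    by_contra h
    exact hy (Finsupp.single_eq_of_ne h))
  self := Finsupp.single_eq_same
  natDegree_le y hy := (cs.not_bruhatLT_one y hy).elim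
  bar_eq := by
    rw [klSum, Finsupp.sum_single_index] <;> simp [heckeT_one, heckeBar_one]

open scoped Classical in
/-- The elements `z` with `z ≺ w` and `s z < z`, which index the correction terms of
`C'_s C'_w`. -/
noncomputable def klCorrection (i : B) (w : W) : Finset W :=
  (cs.klPoly w).support.filter fun z => cs.IsLeftDescent z i ∧ cs.KLPrec z w

/-- The leading coefficient `μ(z, w)`, meaningful if `z ≺ w`. -/
noncomputable def klMu (z w : W) : ℤ :=
  (cs.klPoly w z).coeff ((cs.length w - cs.length z - 1) / 2)

open scoped Classical in
/-- The Kazhdan-Lusztig polynomials of `s w` (where `s w > w`), expressed by those of `w` and of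
shorter elements. -/
noncomputable def klStep (i : B) (w : W) : W →₀ ℤ[X] :=
  Finsupp.onFinset
      ((cs.klPoly w).support ∪ (cs.klPoly w).support.image (cs.simple i * ·))
      (fun y => if cs.IsLeftDescent y i then cs.klPoly w (cs.simple i * y) + .X * cs.klPoly w y
        else .X * cs.klPoly w (cs.simple i * y) + cs.klPoly w y)
      (fun y hy => by
        rw [Finset.mem_union, Finset.mem_image]
        by_contra! hne
        have h1 : cs.klPoly w y = 0 := by simpa using hne.1
        have h2 : cs.klPoly w (cs.simple i * y) = 0 := by
          by_contra h0
          exact hne.2 _ (Finsupp.mem_support_iff.2 h0) (by simp)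
        simp [h1, h2] at hy) -
    ∑ z ∈ cs.klCorrection i w,
      (Polynomial.C (cs.klMu z w) * Polynomial.X ^ ((cs.length w - cs.length z + 1) / 2) : ℤ[X]) •
        cs.klPoly z

open scoped Classical in
theorem klStep_apply (i : B) (w y : W) : cs.klStep i w y =
    (if cs.IsLeftDescent y i then cs.klPoly w (cs.simple i * y) + .X * cs.klPoly w y
        else .X * cs.klPoly w (cs.simple i * y) + cs.klPoly w y) -
    ∑ z ∈ cs.klCorrection i w,
      Polynomial.C (cs.klMu z w) * Polynomial.X ^ ((cs.length w - cs.length z + 1) / 2) *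
        cs.klPoly z y := by
  rw [klStep, Finsupp.sub_apply, Finsupp.finsetSum_apply]
  rfl

variable {cs}

theorem mem_klCorrection {i : B} {w z : W} :
    z ∈ cs.klCorrection i w ↔ cs.IsLeftDescent z i ∧ cs.KLPrec z w := by
  classical
  rw [klCorrection, Finset.mem_filter, and_iff_right_iff_imp, Finsupp.mem_support_iff]
  intro h h0
  exact h.2.2.2 (by rw [h0, Polynomial.coeff_zero])

theorem klSum_klStep {i : B} {w : W} (hw : ¬ cs.IsLeftDescent w i) :
    cs.klSum (cs.simple i * w) (cs.klStep i w) =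
      cs.klGen i * cs.klC w - ∑ z ∈ cs.klCorrection i w, cs.klMu z w • cs.klC z := by
  classical
  refine cs.heckeBasis.repr.injective (Finsupp.ext fun y => ?_)
  have hs : ∀ z ∈ cs.klCorrection i w, (T (-(cs.length w : ℤ) - 1) *
      T (2 : ℤ) ^ ((cs.length w - cs.length z + 1) / 2) : ℤ[T;T⁻¹]) = T (-(cs.length z : ℤ)) := by
    intro z hz
    obtain ⟨-, hlt, ⟨k, hk⟩, -⟩ := mem_klCorrection.1 hz
    have := hlt.length_lt
    rw [LaurentPolynomial.T_pow, ← LaurentPolynomial.T_add]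
    congr 1
    omega
  have e : (T (-1) * T (-(cs.length w : ℤ)) : ℤ[T;T⁻¹]) = T (-(cs.length w : ℤ) - 1) := by
    rw [← LaurentPolynomial.T_add]; congr 1; ring
  have e' : -((cs.length w + 1 : ℕ) : ℤ) = -(cs.length w : ℤ) - 1 := by push_cast; ring
  simp only [repr_klSum, klStep_apply, klC, (cs.not_isLeftDescent_iff).1 hw, map_sub, map_sum,
    Finsupp.sub_apply, Finsupp.finsetSum_apply, map_zsmul, Finsupp.smul_apply, repr_klGen_mul,
    mul_sub, Finset.mul_sum, e']
  congr 1
  · split_ifs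
    · simp only [map_add, map_mul, Polynomial.aeval_X, ← e]; ring
    · simp only [map_add, map_mul, Polynomial.aeval_X, ← e]; ring
  · refine Finset.sum_congr rfl fun z hz => ?_
    rw [map_mul, map_mul, map_pow, Polynomial.aeval_X, Polynomial.aeval_C, ← hs z hz,
      zsmul_eq_mul]
    simp only [eq_intCast]
    ring

theorem natDegree_klStep_le {i : B} {w : W} (hw : ¬ cs.IsLeftDescent w i)
    (ih : ∀ u, cs.length u ≤ cs.length w → cs.IsKLFamily u (cs.klPoly u)) {y : W}
    (hy : cs.BruhatLT y (cs.simple i * w)) : 2 * (cs.klStep i w y).natDegree + 1 ≤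
      cs.length (cs.simple i * w) - cs.length y := by
  classical
  have hlen := hy.length_lt
  rw [(cs.not_isLeftDescent_iff).1 hw] at hlen ⊢
  have hne : cs.simple i * y ≠ w := by
    rintro rfl
    rw [simple_mul_simple_cancel_left] at hy
    exact lt_irrefl _ hy.length_lt
  have hP := ih w le_rfl
  suffices h : (cs.klStep i w y).natDegree ≤ (cs.length w - cs.length y) / 2 by omega
  rw [Polynomial.natDegree_le_iff_coeff_eq_zero]
  intro n hn
  have hn' : cs.length w < 2 * n + cs.length y := by omega
  obtain ⟨m, rfl⟩ : ∃ m, n = m + 1 := ⟨n - 1, by omega⟩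
  -- A correction term contributes in this degree only if it is the one indexed by `y`.
  have hsum : ∀ z ∈ cs.klCorrection i w, (z ≠ y ∨ 2 * m + 1 + cs.length y ≠ cs.length w) →
      (Polynomial.C (cs.klMu z w) * Polynomial.X ^ ((cs.length w - cs.length z + 1) / 2) *
        cs.klPoly z y).coeff (m + 1) = 0 := by
    intro z hz hzy
    obtain ⟨-, hlt, ⟨k, hk⟩, -⟩ := mem_klCorrection.1 hz
    have := hlt.length_lt
    rw [mul_assoc, Polynomial.coeff_C_mul, Polynomial.coeff_X_pow_mul']
    split_ifs with hle
    · by_contra h0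
      rcases (ih z this.le).coeff_ne_zero (right_ne_zero_of_mul h0) with ⟨rfl, h1⟩ | ⟨-, h1⟩
      · rcases hzy with h2 | h2
        · exact h2 rfl
        · omega
      · omega
    · rw [mul_zero]
  rw [klStep_apply, Polynomial.coeff_sub, Polynomial.finsetSum_coeff]
  by_cases hd : cs.IsLeftDescent y i
  · have hl := (cs.isLeftDescent_iff).1 hd
    have h1 : (cs.klPoly w (cs.simple i * y)).coeff (m + 1) = 0 := by
      by_contra h0
      rcases hP.coeff_ne_zero h0 with ⟨h1, -⟩ | ⟨-, h1⟩
      · exact hne h1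
      · omega
    rw [if_pos hd, Polynomial.coeff_add, h1, zero_add, Polynomial.coeff_X_mul]
    by_cases h2 : (cs.klPoly w y).coeff m = 0
    · rw [h2, Finset.sum_eq_zero, sub_zero]
      intro z hz
      refine hsum z hz ?_
      by_contra! h3
      obtain ⟨rfl, h3⟩ := h3
      refine (mem_klCorrection.1 hz).2.2.2 ?_
      rwa [show (cs.length w - cs.length z - 1) / 2 = m by omega]
    · -- The coefficient of `P_{y,w}` that violates the degree bound is `μ(y, w)`, and it cancels.
      rcases hP.coeff_ne_zero h2 with ⟨rfl, -⟩ | ⟨hlt, h3⟩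
      · exact (hw hd).elim
      have hm : (cs.length w - cs.length y - 1) / 2 = m := by omega
      have hmem : y ∈ cs.klCorrection i w := by
        refine mem_klCorrection.2 ⟨hd, hlt, ⟨m, by omega⟩, ?_⟩
        rwa [hm]
      rw [Finset.sum_eq_single_of_mem y hmem fun z hz hzy => hsum z hz (Or.inl hzy),
        (ih y hlt.length_lt.le).self, mul_one, Polynomial.coeff_C_mul, Polynomial.coeff_X_pow,
        if_pos (by omega), mul_one, klMu, hm, sub_self]
  · have hl := (cs.not_isLeftDescent_iff).1 hd
    rw [if_neg hd, Polynomial.coeff_add, Polynomial.coeff_X_mul, Finset.sum_eq_zero, sub_zero]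
    · have h1 : (cs.klPoly w (cs.simple i * y)).coeff m = 0 := by
        by_contra h0
        rcases hP.coeff_ne_zero h0 with ⟨h1, -⟩ | ⟨-, h1⟩
        · exact hne h1
        · omega
      have h2 : (cs.klPoly w y).coeff (m + 1) = 0 := by
        by_contra h0
        rcases hP.coeff_ne_zero h0 with ⟨-, h1⟩ | ⟨-, h1⟩ <;> omega
      rw [h1, h2, add_zero]
    · intro z hz
      refine hsum z hz (Or.inl ?_)
      rintro rfl
      exact hd (mem_klCorrection.1 hz).1

theorem isKLFamily_klStep {i : B} {w : W} (hw : ¬ cs.IsLeftDescent w i)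
    (ih : ∀ u, cs.length u ≤ cs.length w → cs.IsKLFamily u (cs.klPoly u)) :
    cs.IsKLFamily (cs.simple i * w) (cs.klStep i w) := by
  classical
  have hP := ih w le_rfl
  have hl := (cs.not_isLeftDescent_iff).1 hw
  have ih' : ∀ z ∈ cs.klCorrection i w, cs.BruhatLT z w ∧ cs.IsKLFamily z (cs.klPoly z) :=
    fun z hz => ⟨(mem_klCorrection.1 hz).2.1, ih z (mem_klCorrection.1 hz).2.1.length_lt.le⟩
  refine ⟨fun y hy => ?_, ?_, fun y hy => natDegree_klStep_le hw ih hy, ?_⟩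
  · rw [← bruhatLE_iff]
    by_contra hne
    have h1 : cs.klPoly w (cs.simple i * y) = 0 := by
      by_contra h0
      refine hne ?_
      simpa using (hP.bruhatLE h0).simple_mul_le_simple_mul hw
    have h2 : cs.klPoly w y = 0 := by
      by_contra h0
      exact hne ((hP.bruhatLE h0).le_simple_mul hw)
    refine hy ?_
    rw [klStep_apply, h1, h2, Finset.sum_eq_zero]
    · simp
    intro z hz
    obtain ⟨h3, h4⟩ := ih' z hz
    have h5 : cs.klPoly z y = 0 := by
      by_contra h0
      have h6 : cs.BruhatLE y w := (h4.bruhatLE h0).trans (bruhatLE_iff.2 (Or.inr h3))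
      exact hne (h6.le_simple_mul hw)
    rw [h5, mul_zero]
  · have h0 : ∀ u, cs.length u ≤ cs.length w → cs.klPoly u (cs.simple i * w) = 0 := by
      intro u hu
      by_contra h0
      have := ((ih u hu).bruhatLE h0).length_le
      omega
    have hd : cs.IsLeftDescent (cs.simple i * w) i := by
      rw [cs.isLeftDescent_iff]; simp [hl]
    rw [klStep_apply, if_pos hd, simple_mul_simple_cancel_left, hP.self, h0 w le_rfl,
      Finset.sum_eq_zero]
    · simp
    · intro z hz
      rw [h0 z (ih' z hz).1.length_lt.le, mul_zero]
  · rw [klSum_klStep hw]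
    have hb : ∀ u, cs.length u ≤ cs.length w → cs.heckeBarₗ (cs.klC u) = cs.klC u :=
      fun u hu => (ih u hu).bar_eq
    change cs.heckeBarₗ _ = _
    rw [map_sub, map_sum]
    congr 1
    · exact (cs.heckeBar_klGen_mul _ _).trans (congrArg _ (hb w le_rfl))
    · refine Finset.sum_congr rfl fun z hz => ?_
      rw [map_zsmul, hb z (ih' z hz).1.length_lt.le]

variable (cs)

/-- The Kazhdan-Lusztig polynomials exist. -/
theorem isKLFamily_klPoly (w : W) : cs.IsKLFamily w (cs.klPoly w) := by
  induction hn : cs.length w using Nat.strong_induction_on generalizing w with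
  | _ n ih =>
    refine Classical.epsilon_spec (p := cs.IsKLFamily w) ?_
    by_cases hw : w = 1
    · exact hw ▸ ⟨_, cs.isKLFamily_one⟩
    obtain ⟨i, hi⟩ := cs.exists_leftDescent_of_ne_one hw
    have hl := cs.isLeftDescent_iff.1 hi
    have h := isKLFamily_klStep (cs.isLeftDescent_iff_not_isLeftDescent_mul.1 hi)
      fun u hu => ih _ (by omega) u rfl
    rw [simple_mul_simple_cancel_left] at h
    exact ⟨_, h⟩

theorem klC_one : cs.klC 1 = 1 := by
  rw [klC, (cs.isKLFamily_klPoly 1).klSum_eq cs.isKLFamily_one, klSum, Finsupp.sum_single_index]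
    <;> simp [heckeT_one]

variable {cs}

/-- `C'_s C'_w = C'_{sw} + ∑ μ(z, w) C'_z` if `s w > w`, the sum being over `z ≺ w` with
`s z < z`. -/
theorem klGen_mul_klC_of_not_isLeftDescent {i : B} {w : W} (hw : ¬ cs.IsLeftDescent w i) :
    cs.klGen i * cs.klC w =
      cs.klC (cs.simple i * w) + ∑ z ∈ cs.klCorrection i w, cs.klMu z w • cs.klC z := by
  rw [klC.eq_def cs (cs.simple i * w), (cs.isKLFamily_klPoly _).klSum_eq
    (isKLFamily_klStep hw fun u _ => cs.isKLFamily_klPoly u), klSum_klStep hw, sub_add_cancel]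

/-- `C'_s C'_w = (t + t⁻¹) C'_w` if `s w < w`. -/
theorem klGen_mul_klC_of_isLeftDescent {i : B} {w : W} (hw : cs.IsLeftDescent w i) :
    cs.klGen i * cs.klC w = (T 1 + T (-1) : ℤ[T;T⁻¹]) • cs.klC w := by
  induction hn : cs.length w using Nat.strong_induction_on generalizing w with
  | _ n ih =>
    have hw' := cs.isLeftDescent_iff_not_isLeftDescent_mul.1 hw
    have hl := cs.isLeftDescent_iff.1 hw
    have h := klGen_mul_klC_of_not_isLeftDescent hw'
    rw [simple_mul_simple_cancel_left, ← sub_eq_iff_eq_add] at h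
    rw [← h, mul_sub, ← mul_assoc, klGen_mul_self, smul_sub, smul_mul_assoc, Finset.mul_sum,
      Finset.smul_sum]
    congr 1
    refine Finset.sum_congr rfl fun z hz => ?_
    obtain ⟨h1, h2, -⟩ := mem_klCorrection.1 hz
    have := h2.length_lt
    rw [mul_smul_comm, ih _ (by omega) h1 rfl, smul_comm]

variable (cs)

theorem klC_simple (i : B) : cs.klC (cs.simple i) = cs.klGen i := by
  have h := klGen_mul_klC_of_not_isLeftDescent (cs.not_isLeftDescent_one i)
  rw [klC_one, mul_one, mul_one, Finset.sum_eq_zero, add_zero] at h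
  · exact h.symm
  · intro z hz
    exact (cs.not_bruhatLT_one z (mem_klCorrection.1 hz).2.1).elim

theorem aeval_T_two_injective :
    Function.Injective (Polynomial.aeval (T 2 : ℤ[T;T⁻¹]) : ℤ[X] → ℤ[T;T⁻¹]) := by
  have : (Polynomial.aeval (T 2 : ℤ[T;T⁻¹]) : ℤ[X] →ₐ[ℤ] ℤ[T;T⁻¹]) =
      Polynomial.toLaurentAlg.comp (Polynomial.expand ℤ 2) := by
    ext1
    simp
  rw [this]
  exact Polynomial.toLaurent_injective.comp (Polynomial.expand_injective two_pos)

variable {cs}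

/-- `w ≺ s w` if `s w > w`, since `P_{w,sw} = P_{sw,sw} = 1`. -/
theorem klPrec_simple_mul {i : B} {w : W} (hw : ¬ cs.IsLeftDescent w i) :
    cs.KLPrec w (cs.simple i * w) := by
  classical
  have hl := (cs.not_isLeftDescent_iff).1 hw
  have hd : cs.IsLeftDescent (cs.simple i * w) i := by rw [cs.isLeftDescent_iff]; simp [hl]
  refine ⟨.single (bruhatStep_simple_mul hw), by simp [hl], ?_⟩
  have h := congrArg (fun h => cs.heckeBasis.repr h w) (klGen_mul_klC_of_isLeftDescent hd)
  simp only [repr_klGen_mul, if_neg hw, map_smul, Finsupp.smul_apply, smul_eq_mul, klC, repr_klSum,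
    (cs.isKLFamily_klPoly (cs.simple i * w)).self, map_one, mul_one] at h
  set a := Polynomial.aeval (T 2 : ℤ[T;T⁻¹]) (cs.klPoly (cs.simple i * w) w) with ha
  have e : (T (-1) * T 2 : ℤ[T;T⁻¹]) = T 1 := by rw [← LaurentPolynomial.T_add]; rfl
  have h1 : (T 1 * T (-(cs.length (cs.simple i * w) : ℤ)) : ℤ[T;T⁻¹]) * a =
      (T 1 * T (-(cs.length (cs.simple i * w) : ℤ))) * 1 := by
    linear_combination -h + T (-(cs.length (cs.simple i * w) : ℤ)) * e
  have h2 : a = 1 := ((LaurentPolynomial.isUnit_T 1).mul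
    (LaurentPolynomial.isUnit_T _)).mul_left_cancel h1
  have h3 : cs.klPoly (cs.simple i * w) w = 1 := aeval_T_two_injective (by rw [← ha, h2, map_one])
  simp [h3, hl]

end KLBasis

end CoxeterSystem

/-! ### Invariance of symmetric bilinear forms -/

namespace LinearMap.BilinForm

/-- Let `f` be an endomorphism that multiplies the generators `c x` (`x ∈ D`) by `δ ≠ 0` and maps
the other generators into the span of the `c x` (`x ∈ D`). A symmetric form for which `f` is
self-adjoint on the pairs in `D × Dᶜ` is then invariant under `f`. -/
theorem invariant_iff_of_eigenvectors {K V ι : Type*} [CommRing K] [IsDomain K] [AddCommGroup V]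
    [Module K V] {c : ι → V} (hc : Submodule.span K (Set.range c) = ⊤) {f : Module.End K V}
    {D : Set ι} {δ : K} (hδ : δ ≠ 0) (hD : ∀ x ∈ D, f (c x) = δ • c x)
    (hD' : ∀ w ∉ D, f (c w) ∈ Submodule.span K (c '' D)) {β : LinearMap.BilinForm K V}
    (hβ : β.IsSymm) :
    (∀ x ∈ D, ∀ w ∉ D, δ * β (c x) (c w) = β (c x) (f (c w))) ↔
      ∀ v v', β (f v) v' = β v (f v') := by
  constructor
  · intro h
    have hs : ∀ v v', β v v' = β v' v := hβ.eq
    have h1 : ∀ w ∉ D, ∀ v ∈ Submodule.span K (c '' D), δ * β v (c w) = β v (f (c w)) := by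
      intro w hw v hv
      induction hv using Submodule.span_induction with
      | zero => simp
      | add a b _ _ ha hb => simp only [map_add, LinearMap.add_apply, mul_add, ha, hb]
      | smul k a _ ha => simp only [map_smul, LinearMap.smul_apply, smul_eq_mul, ← ha]; ring
      | mem a ha => obtain ⟨x, hx, rfl⟩ := ha; exact h x hx w hw
    have h2 : ∀ x y, β (f (c x)) (c y) = β (c x) (f (c y)) := by
      intro x y
      by_cases hx : x ∈ D <;> by_cases hy : y ∈ D
      · rw [hD x hx, hD y hy]; simp
      · rw [hD x hx, ← h x hx y hy]; simp
      · rw [hD y hy, map_smul, smul_eq_mul, hs (f (c x)), hs (c x), h y hy x hx]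
      · -- After multiplication by `δ`, both sides become `β (f (c x)) (f (c y))`.
        refine mul_left_cancel₀ hδ ?_
        rw [h1 y hy _ (hD' x hx), hs (c x), h1 x hx _ (hD' y hy), hs (f (c y))]
    have h3 : β.comp f LinearMap.id = β.comp LinearMap.id f := by
      refine LinearMap.ext_on hc ?_
      rintro _ ⟨x, rfl⟩
      refine LinearMap.ext_on hc ?_
      rintro _ ⟨y, rfl⟩
      exact h2 x y
    exact fun v v' => LinearMap.congr_fun (LinearMap.congr_fun h3 v) v'
  · intro h x hx w _
    rw [← h, hD x hx, map_smul, LinearMap.smul_apply, smul_eq_mul]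

end LinearMap.BilinForm

namespace CoxeterSystem

variable {B W : Type*} [Group W] {M : CoxeterMatrix B} (cs : CoxeterSystem M W)

/-! ### The left cell representation -/

section LeftCell

open LaurentPolynomial (T)

variable {cs}

theorem mul_mem_of_klGen_mul_mem {N : Submodule ℤ[T;T⁻¹] cs.HeckeAlgebra}
    (hN : ∀ i, ∀ h ∈ N, cs.klGen i * h ∈ N) (a : cs.HeckeAlgebra) {h : cs.HeckeAlgebra}
    (hh : h ∈ N) : a * h ∈ N := by
  induction cs.heckeBasis.mem_span a using Submodule.span_induction with
  | zero => rw [zero_mul]; exact N.zero_mem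
  | add a b _ _ ha hb => rw [add_mul]; exact N.add_mem ha hb
  | smul c a _ ha => rw [smul_mul_assoc]; exact N.smul_mem c ha
  | mem a ha =>
    obtain ⟨w, rfl⟩ := ha
    rw [heckeBasis_apply]
    induction hn : cs.length w generalizing w with
    | zero => rw [cs.length_eq_zero_iff.1 hn, heckeT_one, one_mul]; exact hh
    | succ n ih =>
      have hw : w ≠ 1 := by rintro rfl; simp at hn
      obtain ⟨i, hi⟩ := cs.exists_leftDescent_of_ne_one hw
      have hl := cs.isLeftDescent_iff.1 hi
      have h1 := cs.heckeT_simple_mul_of_not_isLeftDescent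
        (cs.isLeftDescent_iff_not_isLeftDescent_mul.1 hi)
      rw [simple_mul_simple_cancel_left] at h1
      have h2 := ih (cs.simple i * w) (by omega)
      rw [← h1, mul_assoc, heckeT_simple_eq, sub_mul, one_mul, smul_mul_assoc]
      exact N.sub_mem (N.smul_mem _ (hN i _ h2)) h2

theorem leftCellLE_simple_mul {i : B} {w : W} (hw : ¬ cs.IsLeftDescent w i) :
    cs.LeftCellLE (cs.simple i * w) w := by
  refine .single ⟨Or.inr (klPrec_simple_mul hw), i, ?_, hw⟩
  rwa [cs.isLeftDescent_iff_not_isLeftDescent_mul, simple_mul_simple_cancel_left]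

theorem leftCellLE_of_mem_klCorrection {i : B} {w z : W} (hw : ¬ cs.IsLeftDescent w i)
    (hz : z ∈ cs.klCorrection i w) : cs.LeftCellLE z w :=
  .single ⟨Or.inl (mem_klCorrection.1 hz).2, i, (mem_klCorrection.1 hz).1, hw⟩

/-- If `s w > w`, then `C'_s C'_w` is a combination of elements `C'_y` with `y ≤_L w` and
`s y < y`. -/
theorem klGen_mul_klC_mem_span {i : B} {w : W} (hw : ¬ cs.IsLeftDescent w i) :
    cs.klGen i * cs.klC w ∈ Submodule.span ℤ[T;T⁻¹]
      (cs.klC '' {y | cs.LeftCellLE y w ∧ cs.IsLeftDescent y i}) := by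
  rw [klGen_mul_klC_of_not_isLeftDescent hw]
  refine add_mem (Submodule.subset_span (Set.mem_image_of_mem _ ⟨leftCellLE_simple_mul hw, ?_⟩))
    (sum_mem fun z hz => zsmul_mem (Submodule.subset_span (Set.mem_image_of_mem _ ?_)) _)
  · rwa [cs.isLeftDescent_iff_not_isLeftDescent_mul, simple_mul_simple_cancel_left]
  · exact ⟨leftCellLE_of_mem_klCorrection hw hz, (mem_klCorrection.1 hz).1⟩

/-- The left ideal of a left cell is spanned by its Kazhdan-Lusztig basis elements already over
`ℤ[t, t⁻¹]`. -/
theorem mem_span_of_mem_leftCellIdeal {C : Set W} {h : cs.HeckeAlgebra}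
    (hh : h ∈ cs.leftCellIdeal C) :
    h ∈ Submodule.span ℤ[T;T⁻¹] (cs.klC '' {y | ∃ w ∈ C, cs.LeftCellLE y w}) := by
  induction hh using Submodule.span_induction with
  | mem a ha => exact Submodule.subset_span ha
  | zero => exact zero_mem _
  | add a b _ _ ha hb => exact add_mem ha hb
  | smul c a _ ha =>
    refine mul_mem_of_klGen_mul_mem (fun i h hh => ?_) c ha
    induction hh using Submodule.span_induction with
    | zero => rw [mul_zero]; exact zero_mem _
    | add a b _ _ ha hb => rw [mul_add]; exact add_mem ha hb
    | smul c a _ ha => rw [mul_smul_comm]; exact Submodule.smul_mem _ _ ha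
    | mem a ha =>
      obtain ⟨y, ⟨w, hw, hy⟩, rfl⟩ := ha
      by_cases hd : cs.IsLeftDescent y i
      · rw [klGen_mul_klC_of_isLeftDescent hd]
        exact Submodule.smul_mem _ _ (Submodule.subset_span ⟨y, ⟨w, hw, hy⟩, rfl⟩)
      · refine Submodule.span_mono (Set.image_mono ?_) (klGen_mul_klC_mem_span hd)
        exact fun z hz => ⟨w, hw, hz.1.trans hy⟩

/-- The class of a combination of elements `C'_y` with `y ∈ E` is a combination of the basis vectors
`c_y` with `y ∈ E ∩ C`, the other `C'_y` being zero in the left cell module. -/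
theorem mk_mem_span_leftCellVec {C E : Set W} (hE : E ⊆ {y | ∃ w ∈ C, cs.LeftCellLE y w})
    {h : cs.HeckeAlgebra} (hh : h ∈ Submodule.span ℤ[T;T⁻¹] (cs.klC '' E))
    (hC : h ∈ cs.leftCellIdeal C) :
    (Submodule.Quotient.mk ⟨h, hC⟩ : cs.LeftCellModule C) ∈
      Submodule.span ℤ[T;T⁻¹] (cs.leftCellVec C '' {y | (y : W) ∈ E}) := by
  set N := Submodule.span ℤ[T;T⁻¹] (cs.leftCellVec C '' {y | (y : W) ∈ E}) with hN
  let q := ((cs.leftCellIdealLT C).comap (cs.leftCellIdeal C).subtype).mkQ.restrictScalars ℤ[T;T⁻¹]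
  let j := (cs.leftCellIdeal C).subtype.restrictScalars ℤ[T;T⁻¹]
  have hle : Submodule.span ℤ[T;T⁻¹] (cs.klC '' E) ≤ (N.comap q).map j := by
    rw [Submodule.span_le]
    rintro _ ⟨y, hy, rfl⟩
    refine ⟨⟨cs.klC y, Submodule.subset_span ⟨y, hE hy, rfl⟩⟩, ?_, rfl⟩
    by_cases hyC : y ∈ C
    · exact Submodule.subset_span ⟨⟨y, hyC⟩, hy, rfl⟩
    · have h0 : q ⟨cs.klC y, Submodule.subset_span ⟨y, hE hy, rfl⟩⟩ = 0 :=
        (Submodule.Quotient.mk_eq_zero _).2 (Submodule.subset_span ⟨y, ⟨hE hy, hyC⟩, rfl⟩)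
      change q _ ∈ N
      rw [h0]
      exact N.zero_mem
  obtain ⟨h', h1, h2⟩ := hle hh
  have h3 : h' = ⟨h, hC⟩ := Subtype.ext h2
  exact h3 ▸ h1

theorem span_leftCellVec (C : Set W) :
    Submodule.span ℤ[T;T⁻¹] (Set.range (cs.leftCellVec C)) = ⊤ := by
  refine eq_top_iff.2 fun m _ => ?_
  obtain ⟨⟨h, hh⟩, rfl⟩ := Submodule.Quotient.mk_surjective _ m
  refine Submodule.span_mono (Set.image_subset_range _ _)
    (mk_mem_span_leftCellVec subset_rfl (mem_span_of_mem_leftCellIdeal hh) hh)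

theorem klGen_smul_leftCellVec_of_isLeftDescent {C : Set W} {i : B} {x : C}
    (hx : cs.IsLeftDescent x i) :
    cs.klGen i • cs.leftCellVec C x = (T 1 + T (-1) : ℤ[T;T⁻¹]) • cs.leftCellVec C x :=
  congrArg Submodule.Quotient.mk (Subtype.ext (klGen_mul_klC_of_isLeftDescent hx))

theorem klGen_smul_leftCellVec_mem_span {C : Set W} {i : B} {w : C}
    (hw : ¬ cs.IsLeftDescent w i) :
    cs.klGen i • cs.leftCellVec C w ∈ Submodule.span ℤ[T;T⁻¹]
      (cs.leftCellVec C '' {y | cs.IsLeftDescent (y : W) i}) := by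
  have h := mk_mem_span_leftCellVec (C := C) (fun y hy => ⟨w, w.2, hy.1⟩)
    (klGen_mul_klC_mem_span hw)
    ((cs.leftCellIdeal C).smul_mem (cs.klGen i) (Submodule.subset_span ⟨w, ⟨w, w.2, .refl⟩, rfl⟩))
  exact Submodule.span_mono (Set.image_mono fun y hy => hy.2) h

variable (K : Type*) [CommRing K] [Algebra ℤ[T;T⁻¹] K]

theorem leftCellRep_apply_one_tmul (C : Set W) (a : cs.HeckeAlgebra) (m : cs.LeftCellModule C) :
    cs.leftCellRep K C a (1 ⊗ₜ m) = 1 ⊗ₜ (a • m) :=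
  rfl

theorem one_tmul_mem_span {C : Set W} {E : Set C} {m : cs.LeftCellModule C}
    (hm : m ∈ Submodule.span ℤ[T;T⁻¹] (cs.leftCellVec C '' E)) :
    (1 : K) ⊗ₜ[ℤ[T;T⁻¹]] m ∈ Submodule.span K (cs.leftCellBasisVec K C '' E) := by
  induction hm using Submodule.span_induction with
  | zero => rw [TensorProduct.tmul_zero]; exact zero_mem _
  | add a b _ _ ha hb => rw [TensorProduct.tmul_add]; exact add_mem ha hb
  | smul c a _ ha =>
    rw [TensorProduct.tmul_smul, ← algebraMap_smul K]; exact Submodule.smul_mem _ _ ha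
  | mem a ha => obtain ⟨y, hy, rfl⟩ := ha; exact Submodule.subset_span ⟨y, hy, rfl⟩

theorem span_leftCellBasisVec (C : Set W) :
    Submodule.span K (Set.range (cs.leftCellBasisVec K C)) = ⊤ := by
  refine eq_top_iff.2 fun v _ => ?_
  induction v using TensorProduct.induction_on with
  | zero => exact zero_mem _
  | add a b ha hb => exact add_mem (ha trivial) (hb trivial)
  | tmul k m =>
    have h : (k ⊗ₜ m : K ⊗[ℤ[T;T⁻¹]] cs.LeftCellModule C) = k • (1 ⊗ₜ m) := by
      rw [TensorProduct.smul_tmul', smul_eq_mul, mul_one]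
    rw [h, ← Set.image_univ]
    refine Submodule.smul_mem _ _ (one_tmul_mem_span K ?_)
    rw [Set.image_univ, span_leftCellVec]
    trivial

theorem leftCellRep_smul_apply (C : Set W) (r : ℤ[T;T⁻¹]) (a : cs.HeckeAlgebra)
    (v : K ⊗[ℤ[T;T⁻¹]] cs.LeftCellModule C) :
    cs.leftCellRep K C (r • a) v = algebraMap ℤ[T;T⁻¹] K r • cs.leftCellRep K C a v := by
  rw [map_smul, LinearMap.smul_apply, algebraMap_smul]

variable {K}

theorem klGen_invariant_iff [IsDomain K] {C : Set W}
    (hK : algebraMap ℤ[T;T⁻¹] K (T 1 + T (-1)) ≠ 0)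
    {β : LinearMap.BilinForm K (K ⊗[ℤ[T;T⁻¹]] cs.LeftCellModule C)} (hβ : β.IsSymm) (s : B) :
    (∀ x w : C, cs.IsLeftDescent x s → ¬ cs.IsLeftDescent w s →
        algebraMap ℤ[T;T⁻¹] K (T 1 + T (-1)) *
            β (cs.leftCellBasisVec K C x) (cs.leftCellBasisVec K C w) =
          β (cs.leftCellBasisVec K C x)
            (cs.leftCellRep K C (cs.klGen s) (cs.leftCellBasisVec K C w))) ↔
      ∀ v v', β (cs.leftCellRep K C (cs.klGen s) v) v' =
        β v (cs.leftCellRep K C (cs.klGen s) v') := by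
  rw [← LinearMap.BilinForm.invariant_iff_of_eigenvectors (span_leftCellBasisVec K C)
    (D := {x | cs.IsLeftDescent (x : W) s}) hK ?_ ?_ hβ]
  · exact ⟨fun h x hx w hw => h x w hx hw, fun h x w hx hw => h x hx w hw⟩
  · intro x hx
    rw [leftCellBasisVec, leftCellRep_apply_one_tmul, klGen_smul_leftCellVec_of_isLeftDescent hx,
      TensorProduct.tmul_smul, algebraMap_smul]
  · intro w hw
    rw [leftCellBasisVec, leftCellRep_apply_one_tmul]
    exact one_tmul_mem_span K (klGen_smul_leftCellVec_mem_span hw)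

/-- Invariance under all `C'_s` is invariance under the Hecke algebra with its anti-involution
`T_y ↦ T_{y⁻¹}`, since the `C'_s` generate the algebra and are fixed by the anti-involution. -/
theorem forall_klGen_invariant_iff {C : Set W}
    {β : LinearMap.BilinForm K (K ⊗[ℤ[T;T⁻¹]] cs.LeftCellModule C)} :
    (∀ (s : B) (v v'), β (cs.leftCellRep K C (cs.klGen s) v) v' =
        β v (cs.leftCellRep K C (cs.klGen s) v')) ↔
      ∀ (y : W) (v v'), β (cs.leftCellRep K C (cs.heckeT y) v) v' =
        β v (cs.leftCellRep K C (cs.heckeT y⁻¹) v') := by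
  constructor
  · intro h y
    have hs : ∀ (s : B) (v v'), β (cs.leftCellRep K C (cs.heckeT (cs.simple s)) v) v' =
        β v (cs.leftCellRep K C (cs.heckeT (cs.simple s)) v') := by
      intro s v v'
      simp only [heckeT_simple_eq, map_sub, map_one, LinearMap.sub_apply, leftCellRep_smul_apply,
        Module.End.one_apply]
      simp only [map_smul, LinearMap.smul_apply, h s v v']
    induction hn : cs.length y generalizing y with
    | zero => simp [cs.length_eq_zero_iff.1 hn, heckeT_one]
    | succ n ih =>
      have hy : y ≠ 1 := by rintro rfl; simp at hn
      obtain ⟨i, hi⟩ := cs.exists_leftDescent_of_ne_one hy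
      have hl := cs.isLeftDescent_iff.1 hi
      obtain ⟨u, rfl⟩ : ∃ u, y = cs.simple i * u := ⟨cs.simple i * y, by simp⟩
      have hu := cs.isLeftDescent_iff_not_isLeftDescent_mul.1 hi
      rw [simple_mul_simple_cancel_left] at hu hl
      have hu' : ¬ cs.IsRightDescent u⁻¹ i := by rwa [isRightDescent_inv_iff]
      intro v v'
      rw [← heckeT_simple_mul_of_not_isLeftDescent _ hu, mul_inv_rev, inv_simple,
        ← heckeT_mul_simple_of_not_isRightDescent hu', map_mul, map_mul, Module.End.mul_apply,
        Module.End.mul_apply, hs, ih u (by omega)]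
  · intro h s v v'
    have h1 := h (cs.simple s) v v'
    rw [inv_simple] at h1
    simp only [klGen, leftCellRep_smul_apply, map_add, map_one, LinearMap.add_apply,
      Module.End.one_apply]
    simp only [map_smul, map_add, LinearMap.smul_apply, LinearMap.add_apply, h1]

end LeftCell

end CoxeterSystem

theorem mainTheorem12 {B W : Type*} [Group W] {M : CoxeterMatrix B} (cs : CoxeterSystem M W)
    (C : Set W) (hC : cs.IsLeftCell C)
    (K : Type*) [CommRing K] [IsDomain K] [Algebra ℤ[T;T⁻¹] K]
    (hK : algebraMap ℤ[T;T⁻¹] K (LaurentPolynomial.T 1 + LaurentPolynomial.T (-1)) ≠ 0)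
    (β : LinearMap.BilinForm K (K ⊗[ℤ[T;T⁻¹]] cs.LeftCellModule C)) (hβ : β.IsSymm) :
    (∀ s : B,
      (∀ x w : C, cs.IsLeftDescent x s → ¬ cs.IsLeftDescent w s →
        algebraMap ℤ[T;T⁻¹] K (LaurentPolynomial.T 1 + LaurentPolynomial.T (-1)) *
            β (cs.leftCellBasisVec K C x) (cs.leftCellBasisVec K C w) =
          β (cs.leftCellBasisVec K C x)
            (cs.leftCellRep K C (cs.klC (cs.simple s)) (cs.leftCellBasisVec K C w))) ↔
      ∀ v v', β (cs.leftCellRep K C (cs.klC (cs.simple s)) v) v' =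
        β v (cs.leftCellRep K C (cs.klC (cs.simple s)) v')) ∧
    ((∀ s : B, ∀ x w : C, cs.IsLeftDescent x s → ¬ cs.IsLeftDescent w s →
        algebraMap ℤ[T;T⁻¹] K (LaurentPolynomial.T 1 + LaurentPolynomial.T (-1)) *
            β (cs.leftCellBasisVec K C x) (cs.leftCellBasisVec K C w) =
          β (cs.leftCellBasisVec K C x)
            (cs.leftCellRep K C (cs.klC (cs.simple s)) (cs.leftCellBasisVec K C w))) ↔
      ∀ (y : W) (v v'), β (cs.leftCellRep K C (cs.heckeT y) v) v' =
        β v (cs.leftCellRep K C (cs.heckeT y⁻¹) v')) := by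
  simp only [CoxeterSystem.klC_simple]
  exact ⟨CoxeterSystem.klGen_invariant_iff hK hβ,
    (forall_congr' (CoxeterSystem.klGen_invariant_iff hK hβ)).trans
      CoxeterSystem.forall_klGen_invariant_iff⟩
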